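/- Let $\mathcal D=\{[2^k\ell,2^k(\ell+1)):k,\ell\in\mathbb Z\}$ be the set of dyadic intervals. For $J\in\mathcal D$ let $J_-,J_+$ be its left and right halves, $|J|$ its length, $h_J=|J|^{-1/2}(\mathbf 1_{J_+}-\mathbf 1_{J_-})$ its Haar function, and let $Ш$ be the dyadic Hilbert transform (Haar shift) on $L^2(\mathbb R)$ (complex-valued functions), $$Ш f=\sum_{J\in\mathcal D}\langle f,h_J\rangle\,\frac{h_{J_+}-h_{J_-}}{\sqrt2}.$$ Let $I,K\in\mathcal D$ with $I\subset\mathbb R^+=[0,\infty)$ and $K\cap I=\emptyset$. Let $M_0\in\mathbb Z$ be the smallest integer with $I\subset[0,2^{M_0}]$, and let $K\wedge I$ denote the minimal dyadic interval containing $K$ and $I$, when it exists. 1. For every $f\in L^2(\mathbb R)$ supported in $I$, $\mathbf 1_KШ f=\Big(\frac1{|I|}\int_I f\Big)\mathbf 1_KШ\mathbf 1_I$. 2. $\mathbf 1_KШ f=0$ for every $f\in L^2(\mathbb R)$ supported in $I$, if $K\subset\mathbb R_-=(-\infty,0]$, and also if $I\subset[2^{M_0-1},2^{M_0}]$ and $K\subset[0,2^{M_0-2}]$.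 3. Let $0\le\eta\le1$ and let $f_0\in L^2(I)$ satisfy one of the following: - the term-by-term derivative of the Fourier series of $f_0$ on $I$ is the Fourier series of a function $f_0'\in L^2(I)$ (periodic $W^{1,2}(I)$), and $|I|\,\|f_0'\|_{L^2(I)}\le2\pi\eta\,\|f_0\|_{L^2(I)}$; or - $f_0\in W^{1,2}(I)$ with weak derivative $f_0'$, and $|I|\,\|f_0'\|_{L^2(I)}\le\pi\eta\,\|f_0\|_{L^2(I)}$. Let $f$ be the extension of $f_0$ by $0$. Then $\|\mathbf 1_KШ f\|_{L^2}^2\ge(1-\eta)^2\,C(I,K)\,\|f\|_{L^2}^2$ with - $C(I,K)=\dfrac{|I||K|}{2^{2(M_0+k+1)}}$ if $K\subset[2^{M_0+k},2^{M_0+k+1}]$ for an integer $k\ge0$; - $C(I,K)=\dfrac{|I||K|}{2^{2(M_0-1)}}$ if $I\subset[2^{M_0-1},2^{M_0}]$ and $K\subset[2^{M_0-2},2^{M_0-1}]$; - $C(I,K)=\dfrac{|I|}{2^{M_0}}$ if $I\subset[2^{M_0-1},2^{M_0}]$ and $K=[0,2^{M_0-1})$; - $C(I,K)=\dfrac{|I||K||K\wedge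 I|^2}{2^{4M_0}}$ if $I,K\subset[2^{M_0-1},2^{M_0}]$ (in this case $K\wedge I$ exists). 4. There is no constant $C>0$ such that $\|\mathbf 1_KШ f\|_{L^2}^2\ge C\|f\|_{L^2}^2$ for all $f\in L^2(\mathbb R)$ supported in $I$. -/

import Mathlib

open MeasureTheory Set
open scoped ContDiff ENNReal

noncomputable section

/-- The dyadic interval `[2^k ℓ, 2^k (ℓ+1))`, encoded by its scale `k` and its position `ℓ`.
The pair `(k, ℓ)` is determined by the interval. -/
structure DyadicInterval where
  scale : ℤ
  pos : ℤ

namespace DyadicInterval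

/-- Left endpoint. -/
def left (J : DyadicInterval) : ℝ := (2 : ℝ) ^ J.scale * (J.pos : ℝ)

/-- Right endpoint. -/
def right (J : DyadicInterval) : ℝ := (2 : ℝ) ^ J.scale * ((J.pos : ℝ) + 1)

/-- The interval as a set of real numbers. -/
def toSet (J : DyadicInterval) : Set ℝ := Ico J.left J.right

/-- The length `|J|`. -/
def length (J : DyadicInterval) : ℝ := (2 : ℝ) ^ J.scale

/-- The left child `J₋`. -/
def childMinus (J : DyadicInterval) : DyadicInterval := ⟨J.scale - 1, 2 * J.pos⟩

/-- The right child `J₊`. -/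
def childPlus (J : DyadicInterval) : DyadicInterval := ⟨J.scale - 1, 2 * J.pos + 1⟩

theorem left_lt_right (J : DyadicInterval) : J.left < J.right := by
  have h : (0 : ℝ) < (2 : ℝ) ^ J.scale := by positivity
  unfold left right
  nlinarith

theorem measurableSet_toSet (J : DyadicInterval) : MeasurableSet J.toSet := measurableSet_Ico

theorem volume_toSet_ne_top (J : DyadicInterval) : volume J.toSet ≠ ⊤ := by
  simp [toSet]

/-- `L` is the minimal dyadic interval `K ∧ I` containing both `K` and `I`. -/
def IsMeet (K I L : DyadicInterval) : Prop :=
  K.toSet ⊆ L.toSet ∧ I.toSet ⊆ L.toSet ∧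
    ∀ L' : DyadicInterval, K.toSet ⊆ L'.toSet → I.toSet ⊆ L'.toSet → L.toSet ⊆ L'.toSet

/-- The indicator function `1_J` as an element of `L²(ℝ)`. -/
def one (J : DyadicInterval) : Lp ℂ 2 (volume : Measure ℝ) :=
  indicatorConstLp 2 J.measurableSet_toSet J.volume_toSet_ne_top (1 : ℂ)

/-- The Haar function `h_J = |J|^{-1/2} (1_{J₊} - 1_{J₋})`. -/
def haar (J : DyadicInterval) : Lp ℂ 2 (volume : Measure ℝ) :=
  (((Real.sqrt J.length)⁻¹ : ℝ) : ℂ) • (J.childPlus.one - J.childMinus.one)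

/-- The image `(h_{J₊} - h_{J₋}) / √2` of the Haar function `h_J` under the Haar shift. -/
def haarShifted (J : DyadicInterval) : Lp ℂ 2 (volume : Measure ℝ) :=
  (((Real.sqrt 2)⁻¹ : ℝ) : ℂ) • (J.childPlus.haar - J.childMinus.haar)

/-- Pointwise multiplication by the indicator function of `K`, on `L²(ℝ)`: `g ↦ 1_K g`. -/
def cut (K : DyadicInterval) (g : Lp ℂ 2 (volume : Measure ℝ)) :
    Lp ℂ 2 (volume : Measure ℝ) :=
  ((Lp.memLp g).indicator K.measurableSet_toSet).toLp (K.toSet.indicator g)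

/-- `f ∈ L²(ℝ)` is supported in `I`. -/
def Supported (I : DyadicInterval) (f : Lp ℂ 2 (volume : Measure ℝ)) : Prop :=
  ∀ᵐ x : ℝ, x ∉ I.toSet → f x = 0

/-- `f₀ ∈ L²(I)`. -/
def MemL2 (I : DyadicInterval) (f₀ : ℝ → ℂ) : Prop :=
  MemLp f₀ 2 (volume.restrict I.toSet)

/-- The norm `‖f₀‖_{L²(I)}`. -/
def l2norm (I : DyadicInterval) (f₀ : ℝ → ℂ) : ℝ :=
  (eLpNorm f₀ 2 (volume.restrict I.toSet)).toReal

/-- The extension of `f₀ ∈ L²(I)` by `0` outside `I`, as an element of `L²(ℝ)`. -/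
def extendZero (I : DyadicInterval) (f₀ : ℝ → ℂ) (h : I.MemL2 f₀) :
    Lp ℂ 2 (volume : Measure ℝ) :=
  ((memLp_indicator_iff_restrict I.measurableSet_toSet).2 h).toLp (I.toSet.indicator f₀)

/-- `f₀ ∈ W^{1,2}(I)` with weak derivative `g₀`. -/
structure HasWeakDeriv (I : DyadicInterval) (f₀ g₀ : ℝ → ℂ) : Prop where
  memL2 : I.MemL2 f₀
  memL2_deriv : I.MemL2 g₀
  integral_eq : ∀ φ : ℝ → ℝ, ContDiff ℝ ∞ φ → HasCompactSupport φ →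
    tsupport φ ⊆ interior I.toSet →
    ∫ x in I.toSet, deriv φ x • f₀ x = - ∫ x in I.toSet, φ x • g₀ x

/-- `f₀ ∈ L²(I)`, and its Fourier series on `I`, differentiated term by term, is the Fourier
series of `g₀ ∈ L²(I)`. -/
structure HasFourierDeriv (I : DyadicInterval) (f₀ g₀ : ℝ → ℂ) : Prop where
  memL2 : I.MemL2 f₀
  memL2_deriv : I.MemL2 g₀
  coeff_eq : ∀ n : ℤ, fourierCoeffOn I.left_lt_right g₀ n =
    (2 * Real.pi * Complex.I * n / I.length) * fourierCoeffOn I.left_lt_right f₀ n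

end DyadicInterval

/-- The dyadic Hilbert transform (Haar shift) `Ш f = ∑_J ⟨f, h_J⟩ (h_{J₊} - h_{J₋})/√2` on
`L²(ℝ)`. The `(h_{J₊} - h_{J₋})/√2` are orthonormal, so the series converges unconditionally
in `L²(ℝ)` for every `f`. (In Mathlib the inner product is linear in its second argument.) -/
def haarShift (f : Lp ℂ 2 (volume : Measure ℝ)) : Lp ℂ 2 (volume : Measure ℝ) :=
  ∑' J : DyadicInterval, (inner ℂ J.haar f) • J.haarShifted

end

/-!
Write `side J = ±1` according to whether `J` is the right or the left child of its parent, and let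
`P` and `P.sibling` be the two children of a dyadic interval `L`. Let `f` be supported in
`P.sibling`. A Haar function `h_J` contributes to `1_P Ш f` only if `J` meets the support of `f` and
its image lives on a set meeting `P`, which forces `J ⊇ L`. All these `h_J` are constant on
`P.sibling`, so only `∫ f` matters, and their contributions can be summed explicitly: `L` contributes
`-(∫ f) / |L|` times `1_{P₊} - 1_{P₋}`, and, since each side occurs squared, the ancestor of
generation `n + 2` of `P` contributes `(∫ f) / |L| * side (P.anc n) / 2 ^ (n + 1)` times `1_P`. With
`P.sideSum` denoting the sum of `side (P.anc n) / 2 ^ (n + 1)` over `n`,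
`1_P Ш f = (∫ f) / |L| * (P.sideSum * 1_P - (1_{P₊} - 1_{P₋}))` (`cut_haarShift_of_sibling`).

Disjoint dyadic intervals `K` and `I` with a common ancestor always lie in two such siblings, whose
parent is `K ∧ I` (`exists_sibling_of_disjoint`, `isMeet_parent`); without a common ancestor,
`1_K Ш f = 0`. The recursion `sideSum P = (side P + sideSum (parent P)) / 2` gives `sideSum = -1` on
`[0, 2^m)` and `sideSum = 0` on `[2^m, 2^(m+1))`, and bounds `1 - |sideSum|` from below inside the
latter interval. This decides where `Ш f` vanishes and how large it is elsewhere.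

It remains to bound `|∫ f|` from below by `‖f‖`. In the periodic case, Parseval's identity for `f₀`
and `f₀'` gives `(1 - η²) |I| ‖f‖² ≤ |∫ f|²`, which is stronger than the bound with `(1 - η)²`. The
case of a weak derivative follows by reflecting `f₀` evenly and `f₀'` oddly at the left endpoint of
`I`: on the doubled interval the Fourier coefficients of the reflected functions are again related
by term-by-term differentiation, because the weak derivative may be tested against sines vanishing
at both endpoints of `I` (`HasWeakDeriv.integral_eq_of_vanish`).

Finally, the Haar function of `I` is nonzero with mean zero, so no lower bound can hold for all `f`.
-/

noncomputable section

/-! ### Combinatorics of dyadic intervals -/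

namespace DyadicInterval

/-- The dyadic parent, the unique dyadic interval of twice the length containing `J`. -/
def parent (J : DyadicInterval) : DyadicInterval := ⟨J.scale + 1, J.pos / 2⟩

/-- The `n`-th dyadic ancestor of `J`, with `J.anc 0 = J`. -/
def anc (J : DyadicInterval) (n : ℕ) : DyadicInterval := parent^[n] J

/-- The side of its parent on which `J` lies: `1` for a right child, `-1` for a left child. -/
def side (J : DyadicInterval) : ℝ := if Even J.pos then -1 else 1

/-- The other child of the parent of `J`. -/
def sibling (J : DyadicInterval) : DyadicInterval :=
  ⟨J.scale, if Even J.pos then J.pos + 1 else J.pos - 1⟩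

theorem ext_iff' {J K : DyadicInterval} : J = K ↔ J.scale = K.scale ∧ J.pos = K.pos := by
  cases J; cases K; simp

theorem length_pos (J : DyadicInterval) : 0 < J.length := by unfold length; positivity

theorem right_sub_left (J : DyadicInterval) : J.right - J.left = J.length := by
  unfold right left length; ring

theorem left_mem (J : DyadicInterval) : J.left ∈ J.toSet := ⟨le_rfl, J.left_lt_right⟩

theorem mem_toSet_iff {J : DyadicInterval} {x : ℝ} :
    x ∈ J.toSet ↔ ⌊x / (2 : ℝ) ^ J.scale⌋ = J.pos := by
  have h : (0 : ℝ) < (2 : ℝ) ^ J.scale := by positivity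
  rw [Int.floor_eq_iff, le_div_iff₀ h, div_lt_iff₀ h, toSet, left, right, mem_Ico,
    mul_comm, mul_comm (_ ^ _) ((_ : ℝ) + 1)]

theorem eq_of_mem {J K : DyadicInterval} {x : ℝ} (hs : J.scale = K.scale)
    (hJ : x ∈ J.toSet) (hK : x ∈ K.toSet) : J = K := by
  rw [mem_toSet_iff] at hJ hK
  rw [ext_iff']
  exact ⟨hs, by rw [← hJ, ← hK, hs]⟩

@[simp] theorem anc_zero (J : DyadicInterval) : J.anc 0 = J := rfl

theorem anc_succ (J : DyadicInterval) (n : ℕ) : J.anc (n + 1) = (J.anc n).parent :=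
  Function.iterate_succ_apply' _ _ _

theorem anc_succ' (J : DyadicInterval) (n : ℕ) : J.anc (n + 1) = J.parent.anc n :=
  Function.iterate_succ_apply _ _ _

@[simp] theorem anc_scale (J : DyadicInterval) (n : ℕ) : (J.anc n).scale = J.scale + n := by
  induction n with
  | zero => simp
  | succ n ih => rw [anc_succ, parent, ih]; push_cast; ring

theorem anc_injective (J : DyadicInterval) : Function.Injective J.anc := fun m n h ↦ by
  have := congrArg scale h
  simpa using this

theorem toSet_subset_parent (J : DyadicInterval) : J.toSet ⊆ J.parent.toSet := by
  intro x hx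
  rw [mem_toSet_iff] at hx ⊢
  have h2 : x / (2 : ℝ) ^ J.parent.scale = x / (2 : ℝ) ^ J.scale / (2 : ℕ) := by
    rw [parent, zpow_add_one₀ two_ne_zero, div_div, Nat.cast_ofNat]
  rw [h2, Int.floor_div_natCast, hx]
  rfl

theorem toSet_subset_anc (J : DyadicInterval) (n : ℕ) : J.toSet ⊆ (J.anc n).toSet := by
  induction n with
  | zero => exact subset_rfl
  | succ n ih => rw [anc_succ]; exact ih.trans (toSet_subset_parent _)

/-- Two dyadic intervals with a common point are nested. -/
theorem exists_anc_eq {J K : DyadicInterval} {x : ℝ} (hs : J.scale ≤ K.scale)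
    (hJ : x ∈ J.toSet) (hK : x ∈ K.toSet) : ∃ n : ℕ, J.anc n = K := by
  obtain ⟨n, hn⟩ := Int.le.dest hs
  exact ⟨n, eq_of_mem (by rw [anc_scale, hn]) (J.toSet_subset_anc n hJ) hK⟩

theorem disjoint_or_exists_anc (J K : DyadicInterval) :
    Disjoint J.toSet K.toSet ∨ (∃ n : ℕ, J.anc n = K) ∨ ∃ n : ℕ, K.anc n = J := by
  by_cases h : Disjoint J.toSet K.toSet
  · exact .inl h
  · obtain ⟨x, hJ, hK⟩ := Set.not_disjoint_iff.1 h
    rcases le_total J.scale K.scale with hs | hs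
    · exact .inr (.inl (exists_anc_eq hs hJ hK))
    · exact .inr (.inr (exists_anc_eq hs hK hJ))

theorem scale_le_of_subset {J K : DyadicInterval} (h : J.toSet ⊆ K.toSet) :
    J.scale ≤ K.scale := by
  have h1 : J.length ≤ K.length := by
    have h2 := (Set.Ico_subset_Ico_iff J.left_lt_right).1 h
    linarith [J.right_sub_left, K.right_sub_left]
  exact (zpow_le_zpow_iff_right₀ one_lt_two).1 h1

theorem exists_anc_eq_of_subset {J K : DyadicInterval} (h : J.toSet ⊆ K.toSet) :
    ∃ n : ℕ, J.anc n = K :=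
  exists_anc_eq (scale_le_of_subset h) J.left_mem (h J.left_mem)

theorem childMinus_parent_of_even {J : DyadicInterval} (h : Even J.pos) : J.parent.childMinus = J := by
  obtain ⟨r, hr⟩ := h
  rw [ext_iff']; simp [parent, childMinus]; omega

theorem childPlus_parent_of_odd {J : DyadicInterval} (h : ¬ Even J.pos) : J.parent.childPlus = J := by
  rw [Int.even_iff] at h
  rw [ext_iff']; simp [parent, childPlus]; omega

@[simp] theorem parent_childMinus (J : DyadicInterval) : J.childMinus.parent = J := by
  rw [ext_iff']; simp [parent, childMinus]

@[simp] theorem parent_childPlus (J : DyadicInterval) : J.childPlus.parent = J := by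
  rw [ext_iff']; simp [parent, childPlus]; omega

theorem childMinus_subset (J : DyadicInterval) : J.childMinus.toSet ⊆ J.toSet := by
  simpa using J.childMinus.toSet_subset_parent

theorem childPlus_subset (J : DyadicInterval) : J.childPlus.toSet ⊆ J.toSet := by
  simpa using J.childPlus.toSet_subset_parent

theorem disjoint_of_scale_eq {J K : DyadicInterval} (hs : J.scale = K.scale) (h : J ≠ K) :
    Disjoint J.toSet K.toSet :=
  Set.disjoint_left.2 fun _ hJ hK ↦ h (eq_of_mem hs hJ hK)

theorem childMinus_ne_childPlus (J : DyadicInterval) : J.childMinus ≠ J.childPlus := by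
  rw [Ne, ext_iff']; simp [childMinus, childPlus]

theorem disjoint_children (J : DyadicInterval) :
    Disjoint J.childMinus.toSet J.childPlus.toSet :=
  disjoint_of_scale_eq rfl J.childMinus_ne_childPlus

theorem mem_children {J : DyadicInterval} {x : ℝ} (hx : x ∈ J.toSet) :
    x ∈ J.childMinus.toSet ∨ x ∈ J.childPlus.toSet := by
  have e : J.left ≤ x ∧ x < J.right := hx
  simp only [toSet, mem_Ico, left, right, childMinus, childPlus] at e ⊢
  have h : (0 : ℝ) < (2 : ℝ) ^ (J.scale - 1) := by positivity
  have h2 : (2 : ℝ) ^ J.scale = 2 * (2 : ℝ) ^ (J.scale - 1) := by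
    rw [zpow_sub_one₀ two_ne_zero]; ring
  rw [h2] at e
  push_cast
  rcases lt_or_ge x ((2 : ℝ) ^ (J.scale - 1) * (2 * J.pos + 1)) with hlt | hge
  · left; constructor <;> nlinarith
  · right; constructor <;> nlinarith

theorem childMinus_length (J : DyadicInterval) : J.childMinus.length = J.length / 2 := by
  simp only [length, childMinus, zpow_sub_one₀ (two_ne_zero' ℝ)]; ring

theorem childPlus_length (J : DyadicInterval) : J.childPlus.length = J.length / 2 := by
  simp only [length, childPlus, zpow_sub_one₀ (two_ne_zero' ℝ)]; ring

theorem parent_length (J : DyadicInterval) : J.parent.length = 2 * J.length := by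
  simp only [length, parent, zpow_add_one₀ (two_ne_zero' ℝ)]; ring

theorem anc_length (J : DyadicInterval) (n : ℕ) : (J.anc n).length = 2 ^ n * J.length := by
  rw [length, anc_scale, zpow_add₀ two_ne_zero, zpow_natCast, length, mul_comm]

theorem side_sq (J : DyadicInterval) : J.side * J.side = 1 := by
  unfold side; split_ifs <;> norm_num

theorem abs_side (J : DyadicInterval) : |J.side| = 1 := by
  unfold side; split_ifs <;> norm_num

theorem parent_sibling (J : DyadicInterval) : J.sibling.parent = J.parent := by
  by_cases h : Even J.pos
  · have := Int.even_iff.1 h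
    rw [ext_iff']; simp [sibling, parent, h]; omega
  · have := Int.even_iff.not.1 h
    rw [ext_iff']; simp [sibling, parent, h]; omega

theorem side_sibling (J : DyadicInterval) : J.sibling.side = -J.side := by
  by_cases h : Even J.pos <;> simp [sibling, side, h, parity_simps]

theorem sibling_ne (J : DyadicInterval) : J.sibling ≠ J := fun h ↦ by
  have := J.side_sibling
  rw [h] at this
  have := J.side_sq
  nlinarith

theorem disjoint_sibling (J : DyadicInterval) : Disjoint J.toSet J.sibling.toSet :=
  disjoint_of_scale_eq rfl J.sibling_ne.symm

theorem anc_sibling (J : DyadicInterval) (n : ℕ) : J.sibling.anc (n + 1) = J.anc (n + 1) := by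
  rw [anc_succ', anc_succ', parent_sibling]

theorem eq_or_eq_sibling {J K : DyadicInterval} (h : J.parent = K.parent) :
    J = K ∨ J = K.sibling := by
  rw [ext_iff'] at h
  simp only [parent] at h
  by_cases h2 : Even K.pos
  · have := Int.even_iff.1 h2
    simp only [ext_iff', sibling, h2, if_true]; omega
  · have := Int.even_iff.not.1 h2
    simp only [ext_iff', sibling, h2, if_false]; omega

/-- Disjoint dyadic intervals with a common ancestor lie in the two halves of their meet. -/
theorem exists_sibling_of_disjoint {K I : DyadicInterval} (hKI : Disjoint K.toSet I.toSet)
    {L : DyadicInterval} (hK : K.toSet ⊆ L.toSet) (hI : I.toSet ⊆ L.toSet) :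
    ∃ P : DyadicInterval, K.toSet ⊆ P.toSet ∧ I.toSet ⊆ P.sibling.toSet ∧
      P.parent.toSet ⊆ L.toSet := by
  obtain ⟨m, hm⟩ := exists_anc_eq_of_subset hK
  induction m generalizing L with
  | zero =>
    rw [anc_zero] at hm
    subst hm
    exact absurd (hI I.left_mem) (Set.disjoint_right.1 hKI I.left_mem)
  | succ m ih =>
    rw [anc_succ] at hm
    obtain ⟨n, hn⟩ := exists_anc_eq_of_subset hI
    cases n with
    | zero =>
      rw [anc_zero] at hn
      subst hn
      exact absurd (hK K.left_mem) (Set.disjoint_left.1 hKI K.left_mem)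
    | succ n =>
      rw [anc_succ] at hn
      rcases eq_or_eq_sibling (hn.trans hm.symm) with h | h
      · obtain ⟨P, h1, h2, h3⟩ := ih (K.toSet_subset_anc m)
          (h ▸ I.toSet_subset_anc n) rfl
        exact ⟨P, h1, h2, h3.trans (hm ▸ toSet_subset_parent _)⟩
      · exact ⟨K.anc m, K.toSet_subset_anc m, h ▸ I.toSet_subset_anc n, by rw [hm]⟩

theorem isMeet_parent {K I P : DyadicInterval} (hK : K.toSet ⊆ P.toSet)
    (hI : I.toSet ⊆ P.sibling.toSet) : IsMeet K I P.parent := by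
  refine ⟨hK.trans P.toSet_subset_parent,
    hI.trans (P.parent_sibling ▸ P.sibling.toSet_subset_parent), fun L' h1 h2 ↦ ?_⟩
  have hKP := hK K.left_mem
  rcases le_or_gt P.parent.scale L'.scale with h | h
  · obtain ⟨n, rfl⟩ := exists_anc_eq h (P.toSet_subset_parent hKP) (h1 K.left_mem)
    exact toSet_subset_anc _ n
  · -- a dyadic interval shorter than the parent meets only one of the two halves
    have hs : L'.scale ≤ P.scale := by simp only [parent] at h; omega
    obtain ⟨n, hn⟩ := exists_anc_eq hs (h1 K.left_mem) hKP
    have : I.left ∈ P.toSet := hn ▸ L'.toSet_subset_anc n (h2 I.left_mem)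
    exact absurd (hI I.left_mem) (Set.disjoint_left.1 P.disjoint_sibling this)

/-- The weighted sum `∑ₙ side (P.anc n) / 2ⁿ⁺¹` of the sides on which the ancestors of `P` lie. -/
def sideSum (P : DyadicInterval) : ℝ := ∑' n : ℕ, (P.anc n).side / 2 ^ (n + 1)

theorem hasSum_inv_two_pow_succ : HasSum (fun n : ℕ ↦ (1 : ℝ) / 2 ^ (n + 1)) 1 := by
  convert hasSum_geometric_two' 1 using 2 with n
  rw [pow_succ]; field_simp

theorem hasSum_sideSum (P : DyadicInterval) :
    HasSum (fun n : ℕ ↦ (P.anc n).side / 2 ^ (n + 1)) P.sideSum := by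
  refine (Summable.of_norm_bounded hasSum_inv_two_pow_succ.summable fun n ↦ ?_).hasSum
  rw [norm_div, Real.norm_eq_abs, abs_side, norm_pow, Real.norm_ofNat]

theorem sideSum_eq (P : DyadicInterval) : P.sideSum = (P.side + P.parent.sideSum) / 2 := by
  have h : HasSum (fun n : ℕ ↦ (P.anc (n + 1)).side / 2 ^ (n + 1 + 1)) (P.parent.sideSum / 2) := by
    have he (n : ℕ) : (P.anc (n + 1)).side / 2 ^ (n + 1 + 1) =
        (P.parent.anc n).side / 2 ^ (n + 1) / 2 := by
      rw [anc_succ', pow_succ, div_div]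
    simp only [he]
    exact P.parent.hasSum_sideSum.div_const 2
  have h2 := (hasSum_nat_add_iff (f := fun n : ℕ ↦ (P.anc n).side / 2 ^ (n + 1)) 1).1 h
  rw [P.hasSum_sideSum.unique h2]
  simp; ring

theorem sideSum_pos_zero (m : ℤ) : sideSum ⟨m, 0⟩ = -1 := by
  have h (n : ℕ) : anc ⟨m, 0⟩ n = ⟨m + n, 0⟩ := by
    induction n with
    | zero => simp
    | succ n ih => rw [anc_succ, ih, parent, ext_iff']; push_cast; exact ⟨by ring, by simp⟩
  rw [sideSum]
  have := hasSum_inv_two_pow_succ.neg.tsum_eq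
  rw [← this]
  refine tsum_congr fun n ↦ ?_
  rw [h, side, if_pos Even.zero, neg_div]

theorem sideSum_pos_one (m : ℤ) : sideSum ⟨m, 1⟩ = 0 := by
  have h : parent ⟨m, 1⟩ = ⟨m + 1, 0⟩ := rfl
  rw [sideSum_eq, h, sideSum_pos_zero]
  simp [side]

/-- Passing from an interval to its parent at most doubles the distance of `|sideSum|` from `1`. -/
theorem one_sub_abs_sideSum_ge (P : DyadicInterval) (n : ℕ) :
    (1 - |(P.anc n).sideSum|) / 2 ^ n ≤ 1 - |P.sideSum| := by
  induction n with
  | zero => simp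
  | succ n ih =>
    refine le_trans ?_ ih
    rw [(P.anc n).sideSum_eq, ← anc_succ, pow_succ', ← div_div]
    gcongr
    have := abs_add_le (P.anc n).side (P.anc (n + 1)).sideSum
    rw [abs_side] at this
    rw [abs_div, abs_two]
    linarith

end DyadicInterval

/-! ### Haar functions and the Haar shift -/

namespace DyadicInterval

/-- The everywhere defined representative of the Haar function `J.haar`. -/
def haarFun (J : DyadicInterval) (x : ℝ) : ℝ :=
  (√J.length)⁻¹ * (J.childPlus.toSet.indicator 1 x - J.childMinus.toSet.indicator 1 x)

theorem coeFn_one (J : DyadicInterval) : J.one =ᵐ[volume] J.toSet.indicator fun _ ↦ (1 : ℂ) :=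
  indicatorConstLp_coeFn

theorem coeFn_haar (J : DyadicInterval) : ∀ᵐ x, J.haar x = J.haarFun x := by
  filter_upwards [Lp.coeFn_smul (((√J.length)⁻¹ : ℝ) : ℂ) (J.childPlus.one - J.childMinus.one),
    Lp.coeFn_sub J.childPlus.one J.childMinus.one, J.childPlus.coeFn_one,
    J.childMinus.coeFn_one] with x h1 h2 h3 h4
  rw [haar, h1, Pi.smul_apply, h2, Pi.sub_apply, h3, h4, haarFun]
  simp only [indicator, Pi.one_apply, smul_eq_mul]
  split_ifs <;> simp

theorem coeFn_haarShifted (J : DyadicInterval) :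
    ∀ᵐ x, J.haarShifted x =
      (((√2)⁻¹ * (J.childPlus.haarFun x - J.childMinus.haarFun x) : ℝ) : ℂ) := by
  filter_upwards [Lp.coeFn_smul (((√2)⁻¹ : ℝ) : ℂ) (J.childPlus.haar - J.childMinus.haar),
    Lp.coeFn_sub J.childPlus.haar J.childMinus.haar, J.childPlus.coeFn_haar,
    J.childMinus.coeFn_haar] with x h1 h2 h3 h4
  rw [haarShifted, h1, Pi.smul_apply, h2, Pi.sub_apply, h3, h4]
  simp

theorem haarFun_of_notMem {J : DyadicInterval} {x : ℝ} (hx : x ∉ J.toSet) : J.haarFun x = 0 := by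
  rw [haarFun, indicator_of_notMem fun h ↦ hx (J.childPlus_subset h),
    indicator_of_notMem fun h ↦ hx (J.childMinus_subset h)]
  simp

theorem haarFun_of_mem_childPlus {J : DyadicInterval} {x : ℝ} (hx : x ∈ J.childPlus.toSet) :
    J.haarFun x = (√J.length)⁻¹ := by
  rw [haarFun, indicator_of_mem hx,
    indicator_of_notMem (Set.disjoint_right.1 J.disjoint_children hx)]
  simp

theorem haarFun_of_mem_childMinus {J : DyadicInterval} {x : ℝ} (hx : x ∈ J.childMinus.toSet) :
    J.haarFun x = -(√J.length)⁻¹ := by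
  rw [haarFun, indicator_of_mem hx,
    indicator_of_notMem (Set.disjoint_left.1 J.disjoint_children hx)]
  simp

theorem parent_haarFun {P : DyadicInterval} {x : ℝ} (hx : x ∈ P.toSet) :
    P.parent.haarFun x = P.side * (√P.parent.length)⁻¹ := by
  by_cases h : Even P.pos
  · rw [haarFun_of_mem_childMinus ((childMinus_parent_of_even h).symm ▸ hx), side, if_pos h]; ring
  · rw [haarFun_of_mem_childPlus ((childPlus_parent_of_odd h).symm ▸ hx), side, if_neg h]; ring

/-- On `P`, the image of `h_{parent P}` is `±h_P / √2`. -/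
theorem parent_haarShifted {P : DyadicInterval} {x : ℝ} (hx : x ∈ P.toSet) :
    (√2)⁻¹ * (P.parent.childPlus.haarFun x - P.parent.childMinus.haarFun x) =
      (√2)⁻¹ * (P.side * P.haarFun x) := by
  by_cases h : Even P.pos
  · have h1 := childMinus_parent_of_even h
    rw [h1, side, if_pos h, haarFun_of_notMem (J := P.parent.childPlus)]
    · ring
    · exact Set.disjoint_left.1 P.parent.disjoint_children (h1.symm ▸ hx)
  · have h1 := childPlus_parent_of_odd h
    rw [h1, side, if_neg h, haarFun_of_notMem (J := P.parent.childMinus)]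
    · ring
    · exact Set.disjoint_right.1 P.parent.disjoint_children (h1.symm ▸ hx)

/-! ### Integrals against Haar functions -/

theorem Supported.setIntegral_eq_zero {I J : DyadicInterval} {f : Lp ℂ 2 (volume : Measure ℝ)}
    (hf : I.Supported f) (h : Disjoint I.toSet J.toSet) : ∫ x in J.toSet, f x = 0 := by
  refine setIntegral_eq_zero_of_ae_eq_zero ?_
  filter_upwards [hf] with x hx hJ
  exact hx (Set.disjoint_right.1 h hJ)

theorem Supported.setIntegral_eq {I J : DyadicInterval} {f : Lp ℂ 2 (volume : Measure ℝ)}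
    (hf : I.Supported f) (h : I.toSet ⊆ J.toSet) :
    ∫ x in J.toSet, f x = ∫ x in I.toSet, f x := by
  refine setIntegral_eq_of_subset_of_ae_sdiff_eq_zero J.measurableSet_toSet.nullMeasurableSet h ?_
  filter_upwards [hf] with x hx hJ
  exact hx hJ.2

theorem Supported.mono {I J : DyadicInterval} {f : Lp ℂ 2 (volume : Measure ℝ)}
    (hf : I.Supported f) (h : I.toSet ⊆ J.toSet) : J.Supported f := by
  filter_upwards [hf] with x hx hJ
  exact hx fun hI ↦ hJ (h hI)

theorem inner_haar (J : DyadicInterval) (f : Lp ℂ 2 (volume : Measure ℝ)) :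
    inner ℂ J.haar f = (((√J.length)⁻¹ : ℝ) : ℂ) *
      ((∫ x in J.childPlus.toSet, f x) - ∫ x in J.childMinus.toSet, f x) := by
  rw [haar, inner_smul_left, inner_sub_left, one, one, L2.inner_indicatorConstLp_one,
    L2.inner_indicatorConstLp_one, Complex.conj_ofReal]

theorem inner_haar_eq_zero {I J : DyadicInterval} {f : Lp ℂ 2 (volume : Measure ℝ)}
    (hf : I.Supported f) (h : Disjoint I.toSet J.toSet) : inner ℂ J.haar f = 0 := by
  rw [inner_haar, hf.setIntegral_eq_zero (h.mono_right J.childPlus_subset),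
    hf.setIntegral_eq_zero (h.mono_right J.childMinus_subset)]
  simp

theorem inner_haar_parent {P : DyadicInterval} {f : Lp ℂ 2 (volume : Measure ℝ)}
    (hf : P.Supported f) : inner ℂ P.parent.haar f =
      (P.side * (√P.parent.length)⁻¹ : ℝ) * ∫ x in P.toSet, f x := by
  rw [inner_haar]
  by_cases h : Even P.pos
  · have h1 := childMinus_parent_of_even h
    have h2 := P.parent.disjoint_children
    rw [h1] at h2
    rw [h1, hf.setIntegral_eq_zero h2, side, if_pos h]
    push_cast; ring
  · have h1 := childPlus_parent_of_odd h
    have h2 := P.parent.disjoint_children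
    rw [h1] at h2
    rw [h1, hf.setIntegral_eq_zero h2.symm, side, if_neg h]
    push_cast; ring

/-- Against a function supported in `P`, a Haar function of a strictly larger interval acts as
a constant. -/
theorem inner_haar_anc {P : DyadicInterval} {f : Lp ℂ 2 (volume : Measure ℝ)}
    (hf : P.Supported f) (n : ℕ) : inner ℂ (P.anc (n + 1)).haar f =
      ((P.anc n).side * (√(P.anc (n + 1)).length)⁻¹ : ℝ) * ∫ x in P.toSet, f x := by
  have h := P.toSet_subset_anc n
  rw [anc_succ, inner_haar_parent (hf.mono h), hf.setIntegral_eq h]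

theorem supported_haar (J : DyadicInterval) : J.Supported J.haar := by
  filter_upwards [J.coeFn_haar] with x hx hJ
  rw [hx, haarFun_of_notMem hJ, Complex.ofReal_zero]

theorem supported_one (J : DyadicInterval) : J.Supported J.one := by
  filter_upwards [J.coeFn_one] with x hx hJ
  rw [hx, indicator_of_notMem hJ]

theorem measureReal_toSet (J : DyadicInterval) : volume.real J.toSet = J.length := by
  rw [toSet, Real.volume_real_Ico_of_le J.left_lt_right.le, right_sub_left]

theorem setIntegral_childPlus_haar (J : DyadicInterval) :
    ∫ x in J.childPlus.toSet, J.haar x = ((√J.length)⁻¹ * (J.length / 2) : ℝ) := by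
  rw [setIntegral_congr_ae (g := fun _ ↦ (((√J.length)⁻¹ : ℝ) : ℂ))
    J.childPlus.measurableSet_toSet]
  · rw [setIntegral_const, measureReal_toSet, childPlus_length, Complex.real_smul]
    push_cast; ring
  · filter_upwards [J.coeFn_haar] with x hx hm
    rw [hx, haarFun_of_mem_childPlus hm]

theorem setIntegral_childMinus_haar (J : DyadicInterval) :
    ∫ x in J.childMinus.toSet, J.haar x = (-((√J.length)⁻¹ * (J.length / 2)) : ℝ) := by
  rw [setIntegral_congr_ae (g := fun _ ↦ ((-(√J.length)⁻¹ : ℝ) : ℂ))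
    J.childMinus.measurableSet_toSet]
  · rw [setIntegral_const, measureReal_toSet, childMinus_length, Complex.real_smul]
    push_cast; ring
  · filter_upwards [J.coeFn_haar] with x hx hm
    rw [hx, haarFun_of_mem_childMinus hm]

theorem integrableOn_toSet (J : DyadicInterval) (f : Lp ℂ 2 (volume : Measure ℝ)) :
    IntegrableOn f J.toSet :=
  integrableOn_Lp_of_measure_ne_top f one_le_two J.volume_toSet_ne_top

theorem setIntegral_haar (J : DyadicInterval) : ∫ x in J.toSet, J.haar x = 0 := by
  have h : J.toSet = J.childMinus.toSet ∪ J.childPlus.toSet :=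
    Set.Subset.antisymm (fun x hx ↦ mem_children hx)
      (union_subset J.childMinus_subset J.childPlus_subset)
  rw [h, setIntegral_union J.disjoint_children J.childPlus.measurableSet_toSet
    (J.childMinus.integrableOn_toSet _) (J.childPlus.integrableOn_toSet _),
    setIntegral_childMinus_haar, setIntegral_childPlus_haar]
  push_cast; ring

theorem inner_haar_self (J : DyadicInterval) : inner ℂ J.haar J.haar = 1 := by
  rw [inner_haar, setIntegral_childMinus_haar, setIntegral_childPlus_haar]
  have h := Real.sq_sqrt J.length_pos.le
  have h0 : √J.length ≠ 0 := (Real.sqrt_pos.2 J.length_pos).ne'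
  have : (√J.length)⁻¹ * ((√J.length)⁻¹ * (J.length / 2) + (√J.length)⁻¹ * (J.length / 2)) = 1 := by
    field_simp
    nlinarith
  exact_mod_cast (by simpa using this)

theorem inner_haar_haar_anc (J : DyadicInterval) (n : ℕ) :
    inner ℂ (J.anc (n + 1)).haar J.haar = 0 := by
  rw [inner_haar_anc J.supported_haar, setIntegral_haar, mul_zero]

theorem orthonormal_haar : Orthonormal ℂ haar := by
  refine ⟨fun J ↦ ?_, fun J K hJK ↦ ?_⟩
  · rw [norm_eq_sqrt_re_inner (𝕜 := ℂ), inner_haar_self]; simp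
  · rcases disjoint_or_exists_anc J K with h | ⟨n, hn⟩ | ⟨n, hn⟩
    · exact inner_haar_eq_zero K.supported_haar h.symm
    · cases n with
      | zero => exact absurd hn hJK
      | succ n => rw [← inner_conj_symm, ← hn, inner_haar_haar_anc, map_zero]
    · cases n with
      | zero => exact absurd hn.symm hJK
      | succ n => rw [← hn, inner_haar_haar_anc]

theorem childMinus_injective : Function.Injective childMinus := fun J K h ↦ by
  rw [← J.parent_childMinus, h, parent_childMinus]

theorem childPlus_injective : Function.Injective childPlus := fun J K h ↦ by
  rw [← J.parent_childPlus, h, parent_childPlus]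

theorem childMinus_ne_childPlus' (J K : DyadicInterval) : J.childMinus ≠ K.childPlus := by
  rw [Ne, ext_iff']; simp only [childMinus, childPlus]; omega

theorem orthonormal_haarShifted : Orthonormal ℂ haarShifted := by
  classical
  have key := orthonormal_iff_ite.1 orthonormal_haar
  rw [orthonormal_iff_ite]
  intro J K
  rw [haarShifted, haarShifted, inner_smul_left, inner_smul_right, inner_sub_left,
    inner_sub_right, inner_sub_right, key, key, key, key, Complex.conj_ofReal,
    if_neg (J.childMinus_ne_childPlus' K), if_neg (K.childMinus_ne_childPlus' J).symm]
  simp only [childMinus_injective.eq_iff, childPlus_injective.eq_iff]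
  split_ifs
  · have h : (√2)⁻¹ * (√2)⁻¹ = (2 : ℝ)⁻¹ := by
      rw [← mul_inv, Real.mul_self_sqrt zero_le_two]
    rw [← mul_assoc, ← Complex.ofReal_mul, h]
    norm_num
  · simp

theorem hasSum_haarShift (f : Lp ℂ 2 (volume : Measure ℝ)) :
    HasSum (fun J : DyadicInterval ↦ (inner ℂ J.haar f : ℂ) • J.haarShifted) (haarShift f) := by
  refine Summable.hasSum ?_
  have h := (orthonormal_haarShifted.orthogonalFamily.summable_iff_norm_sq_summable
    (fun J ↦ (inner ℂ J.haar f : ℂ))).2 (orthonormal_haar.inner_products_summable f)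
  simpa using h

/-! ### Restriction to a dyadic interval -/

theorem coeFn_cut (K : DyadicInterval) (g : Lp ℂ 2 (volume : Measure ℝ)) :
    K.cut g =ᵐ[volume] K.toSet.indicator g :=
  MemLp.coeFn_toLp _

theorem cut_congr {K : DyadicInterval} {g g' : Lp ℂ 2 (volume : Measure ℝ)}
    (h : ∀ᵐ x, x ∈ K.toSet → g x = g' x) : K.cut g = K.cut g' := by
  refine Lp.ext ?_
  filter_upwards [K.coeFn_cut g, K.coeFn_cut g', h] with x h1 h2 h3
  rw [h1, h2]
  by_cases hx : x ∈ K.toSet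
  · simp [hx, h3 hx]
  · simp [hx]

theorem norm_cut_le (K : DyadicInterval) (g : Lp ℂ 2 (volume : Measure ℝ)) :
    ‖K.cut g‖ ≤ ‖g‖ := by
  refine Lp.norm_le_norm_of_ae_le ?_
  filter_upwards [K.coeFn_cut g] with x hx
  rw [hx]
  exact norm_indicator_le_norm_self _ _

/-- Multiplication by `1_K` as a continuous linear map on `L²(ℝ)`. -/
def cutL (K : DyadicInterval) : Lp ℂ 2 (volume : Measure ℝ) →L[ℂ] Lp ℂ 2 (volume : Measure ℝ) :=
  LinearMap.mkContinuous
    { toFun := K.cut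
      map_add' := fun f g ↦ by
        refine Lp.ext ?_
        filter_upwards [K.coeFn_cut (f + g), Lp.coeFn_add f g, Lp.coeFn_add (K.cut f) (K.cut g),
          K.coeFn_cut f, K.coeFn_cut g] with x h1 h2 h3 h4 h5
        rw [h1, h3, Pi.add_apply, h4, h5]
        by_cases hx : x ∈ K.toSet
        · simp only [indicator_of_mem hx, h2, Pi.add_apply]
        · simp [hx]
      map_smul' := fun c f ↦ by
        refine Lp.ext ?_
        filter_upwards [K.coeFn_cut (c • f), Lp.coeFn_smul c f, Lp.coeFn_smul c (K.cut f),
          K.coeFn_cut f] with x h1 h2 h3 h4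
        rw [RingHom.id_apply, h1, h3, Pi.smul_apply, h4]
        by_cases hx : x ∈ K.toSet
        · simp only [indicator_of_mem hx, h2, Pi.smul_apply]
        · simp [hx] } 1
    fun g ↦ by simpa using K.norm_cut_le g

theorem cutL_apply (K : DyadicInterval) (g : Lp ℂ 2 (volume : Measure ℝ)) :
    K.cutL g = K.cut g := rfl

theorem hasSum_cut_haarShift (K : DyadicInterval) (f : Lp ℂ 2 (volume : Measure ℝ)) :
    HasSum (fun J : DyadicInterval ↦ (inner ℂ J.haar f : ℂ) • K.cut J.haarShifted)
      (K.cut (haarShift f)) := by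
  simpa [cutL_apply] using K.cutL.hasSum (hasSum_haarShift f)

theorem cut_zero (K : DyadicInterval) : K.cut 0 = 0 := map_zero K.cutL

theorem cut_haarShifted_eq_zero {K J : DyadicInterval} (h : Disjoint K.toSet J.toSet) :
    K.cut J.haarShifted = 0 := by
  rw [← K.cut_zero]
  refine cut_congr ?_
  filter_upwards [J.coeFn_haarShifted, Lp.coeFn_zero ℂ 2 (volume : Measure ℝ)] with x h1 h2 hx
  have hJ := Set.disjoint_left.1 h hx
  rw [h1, h2, haarFun_of_notMem fun h ↦ hJ (J.childPlus_subset h),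
    haarFun_of_notMem fun h ↦ hJ (J.childMinus_subset h)]
  simp

theorem cut_haarShifted_parent (P : DyadicInterval) :
    P.cut P.parent.haarShifted = (((√2)⁻¹ * P.side : ℝ) : ℂ) • P.haar := by
  refine Lp.ext ?_
  filter_upwards [P.coeFn_cut P.parent.haarShifted, P.parent.coeFn_haarShifted,
    Lp.coeFn_smul (((√2)⁻¹ * P.side : ℝ) : ℂ) P.haar, P.coeFn_haar] with x h1 h2 h3 h4
  rw [h1, h3, Pi.smul_apply, h4]
  by_cases hx : x ∈ P.toSet
  · rw [indicator_of_mem hx, h2, parent_haarShifted hx, smul_eq_mul, ← Complex.ofReal_mul,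
      mul_assoc]
  · rw [indicator_of_notMem hx, haarFun_of_notMem hx]; simp

theorem cut_haarShifted_anc (P : DyadicInterval) (n : ℕ) :
    P.cut (P.anc (n + 2)).haarShifted =
      (((√2)⁻¹ * ((P.anc (n + 1)).side * ((P.anc n).side * (√(P.anc (n + 1)).length)⁻¹)) : ℝ) : ℂ)
        • P.one := by
  refine Lp.ext ?_
  filter_upwards [P.coeFn_cut (P.anc (n + 2)).haarShifted, (P.anc (n + 2)).coeFn_haarShifted,
    Lp.coeFn_smul (((√2)⁻¹ * ((P.anc (n + 1)).side *
      ((P.anc n).side * (√(P.anc (n + 1)).length)⁻¹)) : ℝ) : ℂ) P.one,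
    P.coeFn_one] with x h1 h2 h3 h4
  rw [h1, h3, Pi.smul_apply, h4]
  by_cases hx : x ∈ P.toSet
  · rw [indicator_of_mem hx, indicator_of_mem hx, h2, anc_succ P (n + 1),
      parent_haarShifted (P.toSet_subset_anc _ hx), anc_succ P n,
      parent_haarFun (P.toSet_subset_anc _ hx), smul_eq_mul, mul_one]
  · rw [indicator_of_notMem hx, indicator_of_notMem hx]; simp

/-- Off the support of `f`, the Haar shift of `f` depends only on the mean of `f`: Haar functions
of intervals inside `I` are shifted to functions living in `I`, the others are constant on `I`. -/
theorem cut_haarShift_eq_average_smul {I K : DyadicInterval} (hKI : Disjoint K.toSet I.toSet)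
    {f : Lp ℂ 2 (volume : Measure ℝ)} (hf : I.Supported f) :
    K.cut (haarShift f) = (⨍ x in I.toSet, f x) • K.cut (haarShift I.one) := by
  refine (hasSum_cut_haarShift K f).unique ?_
  have h := (hasSum_cut_haarShift K I.one).const_smul (⨍ x in I.toSet, f x)
  convert! h using 2 with J
  rcases disjoint_or_exists_anc I J with h | ⟨n, rfl⟩ | ⟨n, rfl⟩
  · rw [inner_haar_eq_zero hf h, inner_haar_eq_zero I.supported_one h]; simp
  · cases n with
    | zero => rw [anc_zero, cut_haarShifted_eq_zero hKI]; simp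
    | succ n =>
      rw [inner_haar_anc hf, inner_haar_anc I.supported_one, smul_smul]
      congr 1
      have h1 : ∫ x in I.toSet, I.one x = (I.length : ℂ) := by
        rw [setIntegral_congr_ae (g := fun _ ↦ (1 : ℂ)) I.measurableSet_toSet]
        · rw [setIntegral_const, measureReal_toSet]; simp
        · filter_upwards [I.coeFn_one] with x hx hm
          rw [hx, indicator_of_mem hm]
      have h2 : (I.length : ℂ) ≠ 0 := by exact_mod_cast I.length_pos.ne'
      rw [h1, setAverage_eq, measureReal_toSet, Complex.real_smul, Complex.ofReal_inv]
      field_simp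
  · rw [cut_haarShifted_eq_zero (hKI.mono_right (J.toSet_subset_anc n))]; simp

/-- If no dyadic interval contains both `K` and `I`, then `1_K Ш f = 0` for all `f` supported
in `I`. -/
theorem cut_haarShift_eq_zero {I K : DyadicInterval} (hKI : Disjoint K.toSet I.toSet)
    (h : ∀ n : ℕ, Disjoint K.toSet (I.anc n).toSet)
    {f : Lp ℂ 2 (volume : Measure ℝ)} (hf : I.Supported f) : K.cut (haarShift f) = 0 := by
  refine (hasSum_cut_haarShift K f).unique ?_
  convert! hasSum_zero using 2 with J
  rcases disjoint_or_exists_anc I J with h1 | ⟨n, rfl⟩ | ⟨n, rfl⟩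
  · rw [inner_haar_eq_zero hf h1, zero_smul]
  · rw [cut_haarShifted_eq_zero (h n), smul_zero]
  · rw [cut_haarShifted_eq_zero (hKI.mono_right (J.toSet_subset_anc n)), smul_zero]

/-- The Haar shift of a function supported in one child of a dyadic interval, evaluated on the
other child `P`. Only the ancestors of `P` contribute; the parent contributes the multiple of
the Haar function of `P`, and the `n + 2`-nd ancestor the `n`-th term of `P.sideSum`. -/
theorem cut_haarShift_of_sibling {P : DyadicInterval} {f : Lp ℂ 2 (volume : Measure ℝ)}
    (hf : P.sibling.Supported f) :
    P.cut (haarShift f) = ((∫ x in P.sibling.toSet, f x) * (P.parent.length : ℂ)⁻¹) •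
      ((P.sideSum : ℂ) • P.one - (P.childPlus.one - P.childMinus.one)) := by
  have hsum := P.hasSum_cut_haarShift f
  set c : ℂ := ∫ x in P.sibling.toSet, f x with hc
  -- only strict ancestors of `P` meet both `P` and its sibling
  have hzero : ∀ J ∉ Set.range fun n : ℕ ↦ P.anc (n + 1),
      (inner ℂ J.haar f : ℂ) • P.cut J.haarShifted = 0 := by
    intro J hJ
    rcases disjoint_or_exists_anc P.sibling J with h | ⟨n, rfl⟩ | ⟨n, hn⟩
    · rw [inner_haar_eq_zero hf h, zero_smul]
    · cases n with
      | zero => rw [anc_zero, cut_haarShifted_eq_zero P.disjoint_sibling, smul_zero]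
      | succ n => exact absurd ⟨n, (P.anc_sibling n).symm⟩ hJ
    · rw [cut_haarShifted_eq_zero (P.disjoint_sibling.mono_right (hn ▸ J.toSet_subset_anc n)),
        smul_zero]
  have hinj : Function.Injective fun n : ℕ ↦ P.anc (n + 1) :=
    P.anc_injective.comp (add_left_injective 1)
  rw [← hinj.hasSum_iff hzero] at hsum
  have hsq (J : DyadicInterval) : (√J.parent.length)⁻¹ * ((√2)⁻¹ * (√J.length)⁻¹) =
      J.parent.length⁻¹ := by
    rw [← mul_inv (√2), ← Real.sqrt_mul zero_le_two, ← parent_length, ← mul_inv,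
      Real.mul_self_sqrt J.parent.length_pos.le]
  have htail : HasSum (fun n : ℕ ↦ (inner ℂ (P.anc (n + 2)).haar f : ℂ) •
      P.cut (P.anc (n + 2)).haarShifted) ((c * (P.parent.length : ℂ)⁻¹ * P.sideSum) • P.one) := by
    have h1 := (Complex.hasSum_ofReal.2 P.hasSum_sideSum).mul_left (c * (P.parent.length : ℂ)⁻¹)
    convert! h1.smul_const P.one using 2 with n
    have h2 := inner_haar_anc hf (n + 1)
    rw [anc_sibling, anc_sibling] at h2
    rw [h2, cut_haarShifted_anc, smul_smul, ← hc]
    congr 1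
    have h3 := hsq (P.anc (n + 1))
    rw [← anc_succ, P.anc_length (n + 2)] at h3
    have h4 : (P.anc (n + 1)).side * (√(2 ^ (n + 2) * P.length))⁻¹ *
        ((√2)⁻¹ * ((P.anc (n + 1)).side * ((P.anc n).side * (√(P.anc (n + 1)).length)⁻¹))) =
        P.parent.length⁻¹ * ((P.anc n).side / 2 ^ (n + 1)) := by
      calc _ = ((P.anc (n + 1)).side * (P.anc (n + 1)).side) * (P.anc n).side *
            ((√(2 ^ (n + 2) * P.length))⁻¹ * ((√2)⁻¹ * (√(P.anc (n + 1)).length)⁻¹)) := by ring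
        _ = _ := by
          have := P.length_pos.ne'
          rw [h3, side_sq, parent_length]
          field_simp
          ring
    rw [P.anc_length (n + 2), mul_right_comm, ← Complex.ofReal_mul, h4]
    push_cast; ring
  refine hsum.unique ?_
  rw [← hasSum_nat_add_iff' 1]
  convert! htail using 1
  have h2 := inner_haar_anc hf 0
  rw [anc_sibling, anc_zero, side_sibling, ← hc] at h2
  have h3 := hsq P
  rw [Finset.sum_range_one, Function.comp_apply, h2, anc_succ, anc_zero, cut_haarShifted_parent,
    smul_smul, haar, smul_smul]
  have h4 : (-P.side * (√P.parent.length)⁻¹) * ((√2)⁻¹ * P.side) * (√P.length)⁻¹ =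
      -P.parent.length⁻¹ := by
    rw [← h3]
    linear_combination (-(√P.parent.length)⁻¹ * (√2)⁻¹ * (√P.length)⁻¹) * P.side_sq
  have h5 : ((-P.side * (√P.parent.length)⁻¹ : ℝ) : ℂ) * c * (((√2)⁻¹ * P.side : ℝ) : ℂ) *
      (((√P.length)⁻¹ : ℝ) : ℂ) = -(c * (P.parent.length : ℂ)⁻¹) := by
    rw [mul_right_comm _ c, mul_right_comm _ c, ← Complex.ofReal_mul, ← Complex.ofReal_mul, h4]
    push_cast; ring
  rw [h5, smul_sub, smul_smul]
  module

end DyadicInterval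

/-! ### Wirtinger inequalities -/

/-- Parseval form of Wirtinger's inequality: if the Fourier coefficients of `w` are those of the
derivative of `u` and `w` is small, then the mean of `u` carries most of its `L²` norm. -/
theorem one_sub_sq_mul_integral_le_of_fourierCoeffOn {a b η : ℝ} (hab : a < b) {u w : ℝ → ℂ}
    (hu : MemLp u 2 (volume.restrict (Ioc a b))) (hw : MemLp w 2 (volume.restrict (Ioc a b)))
    (hc : ∀ n : ℤ, fourierCoeffOn hab w n =
      (2 * Real.pi * Complex.I * n / (b - a : ℝ)) * fourierCoeffOn hab u n)
    (hη : (b - a) ^ 2 * ∫ x in a..b, ‖w x‖ ^ 2 ≤ (2 * Real.pi * η) ^ 2 * ∫ x in a..b, ‖u x‖ ^ 2) :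
    (1 - η ^ 2) * (∫ x in a..b, ‖u x‖ ^ 2) ≤ (b - a) * ‖fourierCoeffOn hab u 0‖ ^ 2 := by
  have hL : 0 < b - a := sub_pos.2 hab
  have hsu := hasSum_sq_fourierCoeffOn hab hu
  have hsw := hasSum_sq_fourierCoeffOn hab hw
  have h0 := hasSum_ite_eq (0 : ℤ) (‖fourierCoeffOn hab u 0‖ ^ 2)
  have hle := hasSum_le (fun n : ℤ ↦ ?_) (hsu.mul_left ((2 * Real.pi) ^ 2))
    ((hsw.mul_left ((b - a) ^ 2)).add (h0.mul_left ((2 * Real.pi) ^ 2)))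
  · simp only [smul_eq_mul] at hle
    have hpi : 0 < (2 * Real.pi) ^ 2 := by positivity
    have e (x : ℝ) : (b - a) * ((b - a)⁻¹ * x) = x := by field_simp
    have h1 := mul_le_mul_of_nonneg_left hle hL.le
    rw [mul_left_comm (b - a), e, mul_add, mul_left_comm (b - a) ((b - a) ^ 2), e,
      mul_left_comm (b - a)] at h1
    refine le_of_mul_le_mul_left ?_ hpi
    linarith
  · by_cases hn : n = 0
    · subst hn
      simp only [if_true]
      have : 0 ≤ (b - a) ^ 2 * ‖fourierCoeffOn hab w 0‖ ^ 2 := by positivity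
      linarith
    · have h1 : (1 : ℝ) ≤ (n : ℝ) ^ 2 := by
        have : (1 : ℤ) ≤ n ^ 2 := by
          have := sq_pos_of_ne_zero hn
          omega
        exact_mod_cast this
      have h2 : (b - a) ^ 2 * (2 * Real.pi * 1 * |(n : ℝ)| / (b - a) * ‖fourierCoeffOn hab u n‖) ^ 2 =
          (2 * Real.pi) ^ 2 * ((n : ℝ) ^ 2 * ‖fourierCoeffOn hab u n‖ ^ 2) := by
        rw [← sq_abs (n : ℝ)]
        field_simp
      rw [if_neg hn, mul_zero, add_zero, hc n, norm_mul, norm_div, norm_mul, norm_mul,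
        norm_mul, Complex.norm_I, Complex.norm_ofNat, Complex.norm_real, Complex.norm_real,
        Complex.norm_intCast, Real.norm_of_nonneg Real.pi_pos.le, Real.norm_of_nonneg hL.le, h2]
      exact mul_le_mul_of_nonneg_left (le_mul_of_one_le_left (by positivity) h1) (by positivity)

/-! ### Testing weak derivatives against functions vanishing at the endpoints -/

theorem exists_deriv_smoothTransition_bound : ∃ C : ℝ, 0 ≤ C ∧
    (∀ x, |deriv Real.smoothTransition x| ≤ C) ∧
    ∀ x, 1 < x → deriv Real.smoothTransition x = 0 := by
  have h1 (x : ℝ) (hx : 1 < x) : deriv Real.smoothTransition x = 0 := by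
    have : Real.smoothTransition =ᶠ[nhds x] fun _ ↦ (1 : ℝ) := by
      filter_upwards [Ioi_mem_nhds hx] with y hy
      exact Real.smoothTransition.one_of_one_le (le_of_lt hy)
    rw [this.deriv_eq, deriv_const]
  have h0 (x : ℝ) (hx : x < 0) : deriv Real.smoothTransition x = 0 := by
    have : Real.smoothTransition =ᶠ[nhds x] fun _ ↦ (0 : ℝ) := by
      filter_upwards [Iio_mem_nhds hx] with y hy
      exact Real.smoothTransition.zero_of_nonpos (le_of_lt hy)
    rw [this.deriv_eq, deriv_const]
  have hc : Continuous (deriv Real.smoothTransition) :=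
    (Real.smoothTransition.contDiff (n := 1)).continuous_deriv le_rfl
  obtain ⟨C, hC⟩ := (isCompact_Icc (a := (0 : ℝ)) (b := 1)).exists_bound_of_continuousOn
    hc.continuousOn
  have hC0 : 0 ≤ C := (norm_nonneg _).trans (hC 0 (by simp))
  refine ⟨C, hC0, fun x ↦ ?_, h1⟩
  by_cases hx0 : x < 0
  · rwa [h0 x hx0, abs_zero]
  by_cases hx1 : 1 < x
  · rwa [h1 x hx1, abs_zero]
  · exact hC x ⟨not_lt.1 hx0, not_lt.1 hx1⟩

/-- A smooth function vanishing at the endpoints of `[a, b]` is the limit of test functions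
supported in `(a, b)`, with bounded pointwise convergence of the functions and of their
derivatives. -/
theorem exists_testFunctions_tendsto {a b : ℝ} {φ : ℝ → ℝ} (hφ : ContDiff ℝ ∞ φ)
    (ha : φ a = 0) (hb : φ b = 0) :
    ∃ (ψ : ℕ → ℝ → ℝ) (B : ℝ), (∀ n, ContDiff ℝ ∞ (ψ n)) ∧ (∀ n, HasCompactSupport (ψ n)) ∧
      (∀ n, tsupport (ψ n) ⊆ Ioo a b) ∧
      (∀ n, ∀ x ∈ Ioo a b, |ψ n x| ≤ B) ∧ (∀ n, ∀ x ∈ Ioo a b, |deriv (ψ n) x| ≤ B) ∧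
      (∀ x ∈ Ioo a b, Filter.Tendsto (fun n ↦ ψ n x) Filter.atTop (nhds (φ x))) ∧
      ∀ x ∈ Ioo a b, Filter.Tendsto (fun n ↦ deriv (ψ n) x) Filter.atTop
        (nhds (deriv φ x)) := by
  obtain ⟨C, hC0, hC, hC1⟩ := exists_deriv_smoothTransition_bound
  have hφd : Differentiable ℝ φ := hφ.differentiable (by simp)
  obtain ⟨M', hM'⟩ := (isCompact_Icc (a := a) (b := b)).exists_bound_of_continuousOn
    (hφ.continuous_deriv (by simp)).continuousOn
  set M := max M' 0
  have hM0 : 0 ≤ M := le_max_right _ _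
  have hM : ∀ x ∈ Icc a b, ‖deriv φ x‖ ≤ M := fun x hx ↦ (hM' x hx).trans (le_max_left _ _)
  have hlip {x y : ℝ} (hx : x ∈ Icc a b) (hy : y ∈ Icc a b) : ‖φ y - φ x‖ ≤ M * ‖y - x‖ :=
    (convex_Icc a b).norm_image_sub_le_of_norm_deriv_le (fun z _ ↦ hφd z) hM hx hy
  have hMa (x) (hx : x ∈ Ioo a b) : |φ x| ≤ M * (x - a) := by
    have := hlip (left_mem_Icc.2 (hx.1.trans hx.2).le) (Ioo_subset_Icc_self hx)
    rwa [ha, sub_zero, Real.norm_eq_abs, Real.norm_of_nonneg (sub_pos.2 hx.1).le] at this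
  have hMb (x) (hx : x ∈ Ioo a b) : |φ x| ≤ M * (b - x) := by
    have := hlip (right_mem_Icc.2 (hx.1.trans hx.2).le) (Ioo_subset_Icc_self hx)
    rwa [hb, sub_zero, Real.norm_eq_abs, norm_sub_rev,
      Real.norm_of_nonneg (sub_pos.2 hx.2).le] at this
  set S := Real.smoothTransition
  have hS : ContDiff ℝ ∞ S := Real.smoothTransition.contDiff
  have hSd : Differentiable ℝ S := hS.differentiable (by simp)
  have hS1 (x : ℝ) : |S x| ≤ 1 := by
    rw [abs_of_nonneg (Real.smoothTransition.nonneg x)]; exact Real.smoothTransition.le_one x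
  let N : ℕ → ℝ := fun n ↦ n + 1
  have hN (n : ℕ) : 0 < N n := by positivity
  let ψ : ℕ → ℝ → ℝ := fun n x ↦ φ x * (S (N n * (x - a) - 1) * S (N n * (b - x) - 1))
  have hsupp (n : ℕ) : tsupport (ψ n) ⊆ Icc (a + (N n)⁻¹) (b - (N n)⁻¹) := by
    refine closure_minimal (fun x hx ↦ ?_) isClosed_Icc
    have e : N n * (N n)⁻¹ = 1 := mul_inv_cancel₀ (hN n).ne'
    by_contra hcon
    refine hx ?_
    rw [mem_Icc, not_and_or, not_le, not_le] at hcon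
    rcases hcon with h | h
    · have : S (N n * (x - a) - 1) = 0 :=
        Real.smoothTransition.zero_of_nonpos (by nlinarith [hN n])
      simp [ψ, this]
    · have : S (N n * (b - x) - 1) = 0 :=
        Real.smoothTransition.zero_of_nonpos (by nlinarith [hN n])
      simp [ψ, this]
  have hder (n : ℕ) (x : ℝ) : deriv (ψ n) x =
      deriv φ x * (S (N n * (x - a) - 1) * S (N n * (b - x) - 1)) +
      (N n * φ x * deriv S (N n * (x - a) - 1) * S (N n * (b - x) - 1) -
       N n * φ x * deriv S (N n * (b - x) - 1) * S (N n * (x - a) - 1)) := by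
    have h1 : HasDerivAt (fun x ↦ N n * (x - a) - 1) (N n) x := by
      simpa using (((hasDerivAt_id x).sub_const a).const_mul (N n)).sub_const 1
    have h2 : HasDerivAt (fun x ↦ N n * (b - x) - 1) (-N n) x := by
      simpa using (((hasDerivAt_id x).const_sub b).const_mul (N n)).sub_const 1
    have h3 := (hSd _).hasDerivAt.comp x h1
    have h4 := (hSd _).hasDerivAt.comp x h2
    have h5 := (hφd x).hasDerivAt.mul (h3.mul h4)
    refine (HasDerivAt.deriv h5).trans ?_
    simp only [Function.comp_apply, Pi.mul_apply]
    ring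
  -- where the cutoff varies, `φ` is of the size of the inverse of the slope of the cutoff
  have hcut (n : ℕ) {t y : ℝ} (hy : |y| ≤ M * t) :
      |N n * y * deriv S (N n * t - 1)| ≤ 2 * M * C := by
    by_cases ht : 1 < N n * t - 1
    · rw [hC1 _ ht, mul_zero, abs_zero]; positivity
    · rw [abs_mul, abs_mul, abs_of_pos (hN n)]
      refine mul_le_mul ?_ (hC _) (abs_nonneg _) (by positivity)
      have := mul_le_mul_of_nonneg_left hy (hN n).le
      nlinarith
  have hev (x) (hx : x ∈ Ioo a b) : ∀ᶠ n in Filter.atTop,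
      1 < N n * (x - a) - 1 ∧ 1 < N n * (b - x) - 1 := by
    have hNt : Filter.Tendsto N Filter.atTop Filter.atTop :=
      Filter.tendsto_atTop_add_const_right _ _ tendsto_natCast_atTop_atTop
    filter_upwards [(hNt.atTop_mul_const (sub_pos.2 hx.1)).eventually_gt_atTop 2,
      (hNt.atTop_mul_const (sub_pos.2 hx.2)).eventually_gt_atTop 2] with n h1 h2
    constructor <;> linarith
  refine ⟨ψ, max (M * (b - a)) (M + 4 * M * C), fun n ↦ ?_, fun n ↦ ?_, fun n ↦ ?_,
    fun n x hx ↦ ?_, fun n x hx ↦ ?_, fun x hx ↦ ?_, fun x hx ↦ ?_⟩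
  · exact hφ.mul ((hS.comp (by fun_prop)).mul (hS.comp (by fun_prop)))
  · exact HasCompactSupport.of_support_subset_isCompact isCompact_Icc
      ((subset_tsupport _).trans (hsupp n))
  · refine (hsupp n).trans fun x hx ↦ ?_
    have := inv_pos.2 (hN n)
    exact ⟨by linarith [hx.1], by linarith [hx.2]⟩
  · refine le_max_of_le_left ?_
    rw [abs_mul, abs_mul]
    have h1 := mul_le_one₀ (hS1 (N n * (x - a) - 1)) (abs_nonneg _) (hS1 (N n * (b - x) - 1))
    calc _ ≤ |φ x| * 1 := mul_le_mul_of_nonneg_left h1 (abs_nonneg _)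
      _ ≤ M * (x - a) := by rw [mul_one]; exact hMa x hx
      _ ≤ M * (b - a) := mul_le_mul_of_nonneg_left (by linarith [hx.2]) hM0
  · refine le_max_of_le_right ?_
    rw [hder]
    have h1 : |deriv φ x * (S (N n * (x - a) - 1) * S (N n * (b - x) - 1))| ≤ M := by
      rw [abs_mul, abs_mul]
      have h2 := mul_le_one₀ (hS1 (N n * (x - a) - 1)) (abs_nonneg _) (hS1 (N n * (b - x) - 1))
      calc _ ≤ |deriv φ x| * 1 := mul_le_mul_of_nonneg_left h2 (abs_nonneg _)
        _ ≤ M := by rw [mul_one]; exact hM x (Ioo_subset_Icc_self hx)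
    have h2 : |N n * φ x * deriv S (N n * (x - a) - 1) * S (N n * (b - x) - 1)| ≤ 2 * M * C := by
      rw [abs_mul]
      exact (mul_le_of_le_one_right (abs_nonneg _) (hS1 _)).trans (hcut n (hMa x hx))
    have h3 : |N n * φ x * deriv S (N n * (b - x) - 1) * S (N n * (x - a) - 1)| ≤ 2 * M * C := by
      rw [abs_mul]
      exact (mul_le_of_le_one_right (abs_nonneg _) (hS1 _)).trans (hcut n (hMb x hx))
    rw [abs_le] at h1 h2 h3 ⊢
    constructor <;> linarith
  · refine tendsto_const_nhds.congr' ?_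
    filter_upwards [hev x hx] with n hn
    simp only [ψ, S, Real.smoothTransition.one_of_one_le hn.1.le,
      Real.smoothTransition.one_of_one_le hn.2.le, mul_one]
  · refine tendsto_const_nhds.congr' ?_
    filter_upwards [hev x hx] with n hn
    rw [hder, hC1 _ hn.1, hC1 _ hn.2]
    simp only [S, Real.smoothTransition.one_of_one_le hn.1.le,
      Real.smoothTransition.one_of_one_le hn.2.le]
    ring

namespace DyadicInterval

theorem restrict_toSet (I : DyadicInterval) :
    (volume : Measure ℝ).restrict I.toSet = volume.restrict (Ioo I.left I.right) :=
  restrict_Ioo_eq_restrict_Ico.symm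

theorem setIntegral_toSet {E : Type*} [NormedAddCommGroup E] [NormedSpace ℝ E]
    (I : DyadicInterval) (f : ℝ → E) :
    ∫ x in I.toSet, f x = ∫ x in I.left..I.right, f x := by
  rw [intervalIntegral.integral_of_le I.left_lt_right.le, toSet, integral_Ico_eq_integral_Ioo,
    integral_Ioc_eq_integral_Ioo]

theorem MemL2.integrableOn {I : DyadicInterval} {f : ℝ → ℂ} (hf : I.MemL2 f) :
    IntegrableOn f I.toSet := by
  have : IsFiniteMeasure ((volume : Measure ℝ).restrict I.toSet) :=
    ⟨by rw [Measure.restrict_apply_univ]; exact I.volume_toSet_ne_top.lt_top⟩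
  exact MemLp.integrable one_le_two hf

/-- A weak derivative may be tested against smooth functions that merely vanish at the
endpoints. -/
theorem HasWeakDeriv.integral_eq_of_vanish {I : DyadicInterval} {f g : ℝ → ℂ}
    (h : I.HasWeakDeriv f g) {φ : ℝ → ℝ} (hφ : ContDiff ℝ ∞ φ) (ha : φ I.left = 0)
    (hb : φ I.right = 0) :
    ∫ x in I.toSet, deriv φ x • f x = - ∫ x in I.toSet, φ x • g x := by
  obtain ⟨ψ, B, h1, h2, h3, h4, h5, h6, h7⟩ := exists_testFunctions_tendsto hφ ha hb
  have hf := h.memL2.integrableOn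
  have hg := h.memL2_deriv.integrableOn
  have hmem : ∀ᵐ x ∂(volume : Measure ℝ).restrict I.toSet, x ∈ Ioo I.left I.right := by
    rw [restrict_toSet]; exact ae_restrict_mem measurableSet_Ioo
  have key (u : ℕ → ℝ → ℝ) (v : ℝ → ℝ) (k : ℝ → ℂ) (hk : IntegrableOn k I.toSet)
      (hu : ∀ n, Continuous (u n)) (hB : ∀ n, ∀ x ∈ Ioo I.left I.right, |u n x| ≤ B)
      (hlim : ∀ x ∈ Ioo I.left I.right, Filter.Tendsto (fun n ↦ u n x) Filter.atTop
        (nhds (v x))) :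
      Filter.Tendsto (fun n ↦ ∫ x in I.toSet, u n x • k x) Filter.atTop
        (nhds (∫ x in I.toSet, v x • k x)) := by
    refine tendsto_integral_of_dominated_convergence (fun x ↦ B * ‖k x‖)
      (fun n ↦ (hu n).aestronglyMeasurable.smul hk.aestronglyMeasurable) (hk.norm.const_mul B)
      (fun n ↦ ?_) ?_
    · filter_upwards [hmem] with x hx
      rw [norm_smul]
      exact mul_le_mul_of_nonneg_right (hB n x hx) (norm_nonneg _)
    · filter_upwards [hmem] with x hx
      exact (hlim x hx).smul_const _
  have hl := key (fun n ↦ deriv (ψ n)) (deriv φ) f hf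
    (fun n ↦ (h1 n).continuous_deriv (by simp)) h5 h7
  have hr := (key ψ φ g hg (fun n ↦ (h1 n).continuous) h4 h6).neg
  refine tendsto_nhds_unique hl (hr.congr fun n ↦ ?_)
  rw [h.integral_eq (ψ n) (h1 n) (h2 n)]
  rw [toSet, interior_Ico]
  exact h3 n

end DyadicInterval

/-! ### Reflection at the left endpoint -/

/-- The extension of `f` from `[a, ∞)` to the whole line, even for `s = 1` and odd for `s = -1`
with respect to reflection at `a`. -/
def reflectExtend (a : ℝ) (s : ℝ) (f : ℝ → ℂ) : ℝ → ℂ :=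
  (Ici a).piecewise f fun x ↦ s • f (2 * a - x)

theorem reflectExtend_of_lt {a s x : ℝ} (f : ℝ → ℂ) (hx : a < x) : reflectExtend a s f x = f x :=
  piecewise_eq_of_mem _ _ _ (mem_Ici.2 hx.le)

theorem reflectExtend_reflect {a s x : ℝ} (f : ℝ → ℂ) (hx : a < x) :
    reflectExtend a s f (2 * a - x) = s • f x := by
  rw [reflectExtend, piecewise_eq_of_notMem _ _ _ (by rw [mem_Ici]; linarith)]
  simp

theorem memLp_reflectExtend {a b s : ℝ} {f : ℝ → ℂ}
    (hf : MemLp f 2 (volume.restrict (Ioo a b))) :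
    MemLp (reflectExtend a s f) 2 (volume.restrict (Ioc (2 * a - b) b)) := by
  refine MemLp.piecewise measurableSet_Ici ?_ ?_
  · rw [Measure.restrict_restrict measurableSet_Ici]
    rw [restrict_Ioo_eq_restrict_Icc] at hf
    exact hf.mono_measure (Measure.restrict_mono (fun x hx ↦ ⟨mem_Ici.1 hx.1, hx.2.2⟩ : _ ⊆ Icc a b) le_rfl)
  · rw [Measure.restrict_restrict measurableSet_Ici.compl]
    have hp := (Measure.measurePreserving_sub_left (volume : Measure ℝ) (2 * a)).restrict_preimage
      (measurableSet_Ioc (a := a) (b := b))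
    rw [restrict_Ioo_eq_restrict_Ioc] at hf
    have h := (hf.comp_measurePreserving hp).const_smul s
    rw [preimage_const_sub_Ioc, ← restrict_Ioo_eq_restrict_Ico] at h
    refine h.mono_measure (Measure.restrict_mono (fun x hx ↦ ?_) le_rfl)
    have h1 := hx.1
    simp only [mem_compl_iff, mem_Ici, not_le] at h1
    exact ⟨hx.2.1, by linarith⟩

theorem intervalIntegral_reflect {E : Type*} [NormedAddCommGroup E] [NormedSpace ℝ E]
    {a b : ℝ} (hab : a ≤ b) {H : ℝ → E} (hH : IntervalIntegrable H volume (2 * a - b) b) :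
    ∫ x in (2 * a - b)..b, H x = ∫ x in a..b, (H x + H (2 * a - x)) := by
  have h1 : IntervalIntegrable H volume (2 * a - b) a :=
    hH.mono_set (by rw [uIcc_of_le (by linarith), uIcc_of_le (by linarith)]; gcongr)
  have h2 : IntervalIntegrable H volume a b :=
    hH.mono_set (by rw [uIcc_of_le (by linarith), uIcc_of_le (by linarith)]; gcongr; linarith)
  have h3 : IntervalIntegrable (fun x ↦ H (2 * a - x)) volume a b := by
    have := h1.comp_sub_left (2 * a)
    rw [sub_sub_cancel, show 2 * a - a = a by ring] at this
    exact this.symm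
  rw [intervalIntegral.integral_add h2 h3, intervalIntegral.integral_comp_sub_left,
    show 2 * a - a = a by ring, add_comm, intervalIntegral.integral_add_adjacent_intervals h1 h2]

theorem integral_norm_sq_reflectExtend {a b s : ℝ} (hab : a ≤ b) (hs : |s| = 1) {f : ℝ → ℂ}
    (hf : MemLp f 2 (volume.restrict (Ioo a b))) :
    ∫ x in (2 * a - b)..b, ‖reflectExtend a s f x‖ ^ 2 = 2 * ∫ x in a..b, ‖f x‖ ^ 2 := by
  have hF := memLp_reflectExtend (s := s) hf
  have hint : IntervalIntegrable (fun x ↦ ‖reflectExtend a s f x‖ ^ 2) volume (2 * a - b) b := by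
    rw [intervalIntegrable_iff_integrableOn_Ioc_of_le (by linarith)]
    exact (memLp_two_iff_integrable_sq_norm hF.1).1 hF
  rw [intervalIntegral_reflect hab hint, ← intervalIntegral.integral_const_mul]
  refine intervalIntegral.integral_congr_Ioo_of_le hab fun x hx ↦ ?_
  rw [reflectExtend_of_lt f hx.1, reflectExtend_reflect f hx.1, norm_smul, Real.norm_eq_abs, hs]
  ring

theorem fourierCoeffOn_reflectExtend {a b s : ℝ} (hab : a < b) (hab' : 2 * a - b < b) {f : ℝ → ℂ}
    (hf : MemLp f 2 (volume.restrict (Ioo a b))) (n : ℤ) :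
    fourierCoeffOn hab' (reflectExtend a s f) n = (1 / (2 * (b - a))) • ∫ x in a..b,
      (Complex.exp (-(Real.pi * n * x / (b - a) : ℝ) * Complex.I) +
        s * Complex.exp (-(Real.pi * n * (2 * a - x) / (b - a) : ℝ) * Complex.I)) * f x := by
  have hL : (b : ℂ) - a ≠ 0 := by exact_mod_cast (sub_pos.2 hab).ne'
  have hE (x : ℝ) : fourier (-n) (x : AddCircle (b - (2 * a - b))) =
      Complex.exp (-(Real.pi * n * x / (b - a) : ℝ) * Complex.I) := by
    rw [fourier_coe_apply]
    congr 1
    have : ((b - (2 * a - b) : ℝ) : ℂ) = 2 * (b - a) := by push_cast; ring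
    rw [this]
    push_cast
    field_simp
  have hF := memLp_reflectExtend (s := s) hf
  have hFi : IntervalIntegrable (reflectExtend a s f) volume (2 * a - b) b := by
    rw [intervalIntegrable_iff_integrableOn_Ioc_of_le hab'.le]
    exact hF.integrable one_le_two
  have hint : IntervalIntegrable (fun x ↦
      Complex.exp (-(Real.pi * n * x / (b - a) : ℝ) * Complex.I) * reflectExtend a s f x)
      volume (2 * a - b) b :=
    hFi.continuousOn_mul (Continuous.continuousOn (by fun_prop))
  rw [fourierCoeffOn_eq_integral]
  simp only [hE, smul_eq_mul]
  rw [intervalIntegral_reflect hab.le hint]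
  congr 1
  · congr 1; ring
  · refine intervalIntegral.integral_congr_Ioo_of_le hab.le fun x hx ↦ ?_
    rw [reflectExtend_of_lt f hx.1, reflectExtend_reflect f hx.1, Complex.real_smul]
    ring

namespace DyadicInterval

/-- The even reflection of `f` and the odd reflection of its weak derivative satisfy, on the
doubled interval, the relation between the Fourier coefficients of a function and of its
derivative. -/
theorem HasWeakDeriv.fourierCoeffOn_reflectExtend {I : DyadicInterval} {f g : ℝ → ℂ}
    (h : I.HasWeakDeriv f g) (hab : 2 * I.left - I.right < I.right) (n : ℤ) :
    fourierCoeffOn hab (reflectExtend I.left (-1) g) n =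
      (2 * Real.pi * Complex.I * n / (I.right - (2 * I.left - I.right) : ℝ)) *
        fourierCoeffOn hab (reflectExtend I.left 1 f) n := by
  have hf := h.memL2
  have hg := h.memL2_deriv
  rw [MemL2, restrict_toSet] at hf hg
  rw [_root_.fourierCoeffOn_reflectExtend I.left_lt_right hab hf,
    _root_.fourierCoeffOn_reflectExtend I.left_lt_right hab hg, ← setIntegral_toSet,
    ← setIntegral_toSet]
  set a := I.left with ha
  set b := I.right with hb
  have hL : b - a ≠ 0 := (sub_pos.2 I.left_lt_right).ne'
  have hLc : (b : ℂ) - a ≠ 0 := by exact_mod_cast hL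
  set θ : ℝ := Real.pi * n / (b - a) with hθ
  set Z : ℂ := Complex.exp (-(θ * a : ℝ) * Complex.I) with hZ
  have hexp1 (x : ℝ) : Complex.exp (-(Real.pi * n * x / (b - a) : ℝ) * Complex.I) =
      Z * (Real.cos (θ * (x - a)) - Real.sin (θ * (x - a)) * Complex.I) := by
    have : -((Real.pi * n * x / (b - a) : ℝ) : ℂ) * Complex.I =
        -(θ * a : ℝ) * Complex.I + (-(θ * (x - a) : ℝ) : ℝ) * Complex.I := by
      rw [hθ]; push_cast; field_simp; ring
    rw [this, Complex.exp_add, ← hZ, Complex.exp_mul_I, ← Complex.ofReal_cos, ← Complex.ofReal_sin,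
      Real.cos_neg, Real.sin_neg]
    push_cast; ring
  have hexp2 (x : ℝ) : Complex.exp (-(Real.pi * n * (2 * a - x) / (b - a) : ℝ) * Complex.I) =
      Z * (Real.cos (θ * (x - a)) + Real.sin (θ * (x - a)) * Complex.I) := by
    rw [hexp1, show θ * (2 * a - x - a) = -(θ * (x - a)) by ring, Real.cos_neg, Real.sin_neg]
    push_cast; ring
  simp only [hexp2]
  simp only [hexp1]
  have hi1 : ∫ x in I.toSet, (Z * (Real.cos (θ * (x - a)) - Real.sin (θ * (x - a)) * Complex.I) +
      (1 : ℝ) * (Z * (Real.cos (θ * (x - a)) + Real.sin (θ * (x - a)) * Complex.I))) * f x =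
      2 * Z * ∫ x in I.toSet, Real.cos (θ * (x - a)) • f x := by
    rw [← integral_const_mul]
    congr 1; ext x; rw [Complex.real_smul]; push_cast; ring
  have hi2 : ∫ x in I.toSet, (Z * (Real.cos (θ * (x - a)) - Real.sin (θ * (x - a)) * Complex.I) +
      (-1 : ℝ) * (Z * (Real.cos (θ * (x - a)) + Real.sin (θ * (x - a)) * Complex.I))) * g x =
      -(2 * Z * Complex.I) * ∫ x in I.toSet, Real.sin (θ * (x - a)) • g x := by
    rw [← integral_const_mul]
    congr 1; ext x; rw [Complex.real_smul]; push_cast; ring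
  have hweak := h.integral_eq_of_vanish (φ := fun x ↦ Real.sin (θ * (x - a))) (by fun_prop)
    (by simp [← ha]) (by
      have : θ * (b - a) = n * Real.pi := by rw [hθ]; field_simp
      rw [← hb, this, Real.sin_int_mul_pi])
  have hderiv (x : ℝ) : deriv (fun x ↦ Real.sin (θ * (x - a))) x = θ * Real.cos (θ * (x - a)) := by
    have h1 : HasDerivAt (fun x ↦ θ * (x - a)) θ x := by
      simpa using ((hasDerivAt_id x).sub_const a).const_mul θ
    rw [h1.sin.deriv, mul_comm]
  simp only [hderiv, mul_smul] at hweak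
  rw [integral_smul] at hweak
  rw [hi1, hi2, neg_eq_iff_eq_neg.1 hweak.symm]
  have : ((b - (2 * a - b) : ℝ) : ℂ) = 2 * (b - a) := by push_cast; ring
  rw [this]
  simp only [Complex.real_smul]
  rw [hθ]
  push_cast
  field_simp

theorem MemL2.l2norm_sq {I : DyadicInterval} {f : ℝ → ℂ} (hf : I.MemL2 f) :
    I.l2norm f ^ 2 = ∫ x in I.left..I.right, ‖f x‖ ^ 2 := by
  rw [l2norm, MemLp.eLpNorm_eq_integral_rpow_norm two_ne_zero ENNReal.ofNat_ne_top hf,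
    ← setIntegral_toSet, ENNReal.toReal_ofReal (by positivity), ← Real.rpow_natCast,
    ← Real.rpow_mul (by positivity)]
  simp

theorem norm_extendZero {I : DyadicInterval} {f : ℝ → ℂ} (hf : I.MemL2 f) :
    ‖I.extendZero f hf‖ = I.l2norm f := by
  rw [extendZero, Lp.norm_toLp, eLpNorm_indicator_eq_eLpNorm_restrict I.measurableSet_toSet, l2norm]

/-- **Wirtinger's inequality**, for periodic boundary conditions and, with twice the constant,
without boundary conditions. Bounding the mean from below by `1 - η ^ 2` is equivalent to bounding
the distance of `f` from its mean by `η * ‖f‖`. -/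
theorem one_sub_sq_mul_norm_sq_le {I : DyadicInterval} {η : ℝ} {f g : ℝ → ℂ}
    (hf : I.MemL2 f)
    (h : I.HasFourierDeriv f g ∧ I.length * I.l2norm g ≤ 2 * Real.pi * η * I.l2norm f ∨
      I.HasWeakDeriv f g ∧ I.length * I.l2norm g ≤ Real.pi * η * I.l2norm f) :
    (1 - η ^ 2) * I.length * ‖I.extendZero f hf‖ ^ 2 ≤ ‖∫ x in I.toSet, f x‖ ^ 2 := by
  have hL := I.length_pos
  rw [norm_extendZero]
  have hf' := hf
  rw [MemL2, restrict_toSet] at hf'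
  have hnn (u : ℝ → ℂ) : 0 ≤ I.l2norm u := ENNReal.toReal_nonneg
  rcases h with ⟨h, hle⟩ | ⟨h, hle⟩
  · have hg' := h.memL2_deriv
    rw [MemL2, restrict_toSet, restrict_Ioo_eq_restrict_Ioc] at hg'
    rw [restrict_Ioo_eq_restrict_Ioc] at hf'
    have key := one_sub_sq_mul_integral_le_of_fourierCoeffOn (η := η) I.left_lt_right hf' hg'
      (fun n ↦ by rw [right_sub_left]; exact h.coeff_eq n) (by
        rw [← hf.l2norm_sq, ← h.memL2_deriv.l2norm_sq, right_sub_left, ← mul_pow, ← mul_pow]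
        exact pow_le_pow_left₀ (mul_nonneg hL.le (hnn g)) hle 2)
    rw [fourierCoeffOn_eq_integral, right_sub_left, ← hf.l2norm_sq] at key
    simp only [neg_zero, fourier_zero, one_smul] at key
    rw [← setIntegral_toSet, norm_smul, mul_pow, Real.norm_of_nonneg (by positivity)] at key
    have := mul_le_mul_of_nonneg_left key hL.le
    calc _ = I.length * ((1 - η ^ 2) * I.l2norm f ^ 2) := by ring
      _ ≤ _ := this
      _ = _ := by field_simp
  · have hg' := h.memL2_deriv
    rw [MemL2, restrict_toSet] at hg'
    have hlr := I.left_lt_right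
    have hab : 2 * I.left - I.right < I.right := by linarith
    have hlen : I.right - (2 * I.left - I.right) = 2 * I.length := by
      rw [← right_sub_left]; ring
    have key := one_sub_sq_mul_integral_le_of_fourierCoeffOn (η := η) hab
      (memLp_reflectExtend (s := 1) hf') (memLp_reflectExtend (s := -1) hg')
      (h.fourierCoeffOn_reflectExtend hab) (by
        rw [integral_norm_sq_reflectExtend hlr.le (by simp) hf',
          integral_norm_sq_reflectExtend hlr.le (by simp) hg',
          ← hf.l2norm_sq, ← h.memL2_deriv.l2norm_sq, hlen]
        have := pow_le_pow_left₀ (mul_nonneg hL.le (hnn g)) hle 2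
        rw [mul_pow, mul_pow] at this
        linarith)
    rw [integral_norm_sq_reflectExtend hlr.le (by simp) hf', hlen, ← hf.l2norm_sq,
      _root_.fourierCoeffOn_reflectExtend hlr hab hf', ← setIntegral_toSet] at key
    have e : ∫ x in I.toSet,
        (Complex.exp (-(Real.pi * (0 : ℤ) * x / (I.right - I.left) : ℝ) * Complex.I) +
        (1 : ℝ) * Complex.exp (-(Real.pi * (0 : ℤ) * (2 * I.left - x) / (I.right - I.left) : ℝ) *
          Complex.I)) * f x = 2 * ∫ x in I.toSet, f x := by
      rw [← integral_const_mul]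
      congr 1; ext x; norm_num
    rw [e, norm_smul, norm_mul, Complex.norm_ofNat, right_sub_left,
      Real.norm_of_nonneg (by positivity)] at key
    have := mul_le_mul_of_nonneg_left key hL.le
    have h2 : I.length * (2 * I.length * (1 / (2 * I.length) * (2 * ‖∫ x in I.toSet, f x‖)) ^ 2) =
        2 * ‖∫ x in I.toSet, f x‖ ^ 2 := by field_simp
    rw [h2] at this
    linarith

end DyadicInterval

/-! ### Lower bounds -/

namespace DyadicInterval

theorem coeFn_cut_haarShift {P : DyadicInterval} {f : Lp ℂ 2 (volume : Measure ℝ)}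
    (hf : P.sibling.Supported f) : ∀ᵐ x, P.cut (haarShift f) x =
      ((∫ x in P.sibling.toSet, f x) * (P.parent.length : ℂ)⁻¹) *
        ((P.sideSum : ℂ) * P.toSet.indicator 1 x -
          (P.childPlus.toSet.indicator 1 x - P.childMinus.toSet.indicator 1 x)) := by
  rw [cut_haarShift_of_sibling hf]
  set c : ℂ := (∫ x in P.sibling.toSet, f x) * (P.parent.length : ℂ)⁻¹
  filter_upwards [Lp.coeFn_smul c
      ((P.sideSum : ℂ) • P.one - (P.childPlus.one - P.childMinus.one)),
    Lp.coeFn_sub ((P.sideSum : ℂ) • P.one) (P.childPlus.one - P.childMinus.one),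
    Lp.coeFn_smul (P.sideSum : ℂ) P.one, Lp.coeFn_sub P.childPlus.one P.childMinus.one,
    P.coeFn_one, P.childPlus.coeFn_one, P.childMinus.coeFn_one] with x h1 h2 h3 h4 h5 h6 h7
  rw [h1, Pi.smul_apply, h2, Pi.sub_apply, h3, Pi.smul_apply, h4, Pi.sub_apply, h5, h6, h7]
  rfl

/-- The values of `Ш f` on the two halves of `P`, for `f` supported in `I ⊆ P.sibling`. -/
theorem haarShift_ae {I P : DyadicInterval} {f : Lp ℂ 2 (volume : Measure ℝ)}
    (hf : I.Supported f) (hI : I.toSet ⊆ P.sibling.toSet) : ∀ᵐ x,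
      (x ∈ P.childMinus.toSet → haarShift f x =
        (∫ x in I.toSet, f x) * (((P.sideSum + 1) / P.parent.length : ℝ) : ℂ)) ∧
      (x ∈ P.childPlus.toSet → haarShift f x =
        (∫ x in I.toSet, f x) * (((P.sideSum - 1) / P.parent.length : ℝ) : ℂ)) := by
  filter_upwards [coeFn_cut_haarShift (hf.mono hI), P.coeFn_cut (haarShift f)] with x h1 h2
  rw [h2, hf.setIntegral_eq hI] at h1
  refine ⟨fun hx ↦ ?_, fun hx ↦ ?_⟩
  · have hP := P.childMinus_subset hx
    rw [indicator_of_mem hP, indicator_of_mem hP, indicator_of_mem hx,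
      indicator_of_notMem (Set.disjoint_left.1 P.disjoint_children hx)] at h1
    rw [h1]
    simp only [Pi.one_apply]
    push_cast; ring
  · have hP := P.childPlus_subset hx
    rw [indicator_of_mem hP, indicator_of_mem hP, indicator_of_mem hx,
      indicator_of_notMem (Set.disjoint_right.1 P.disjoint_children hx)] at h1
    rw [h1]
    simp only [Pi.one_apply]
    push_cast; ring

/-- A pointwise lower bound on a dyadic interval `S ⊆ K` gives a lower bound for `‖1_K g‖²`. -/
theorem sq_mul_length_le_norm_cut_sq {S K : DyadicInterval} (hSK : S.toSet ⊆ K.toSet)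
    {g : Lp ℂ 2 (volume : Measure ℝ)} {c : ℝ} (hc : 0 ≤ c)
    (h : ∀ᵐ x, x ∈ S.toSet → c ≤ ‖g x‖) : c ^ 2 * S.length ≤ ‖K.cut g‖ ^ 2 := by
  have h1 : ‖(c : ℂ) • S.one‖ ≤ ‖K.cut g‖ := by
    refine Lp.norm_le_norm_of_ae_le ?_
    filter_upwards [h, Lp.coeFn_smul (c : ℂ) S.one, S.coeFn_one, K.coeFn_cut g]
      with x h1 h2 h3 h4
    rw [h2, Pi.smul_apply, h3, h4]
    by_cases hx : x ∈ S.toSet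
    · rw [indicator_of_mem hx, indicator_of_mem (hSK hx), smul_eq_mul, mul_one,
        Complex.norm_real, Real.norm_of_nonneg hc]
      exact h1 hx
    · rw [indicator_of_notMem hx, smul_zero, norm_zero]
      exact norm_nonneg _
  have h2 : ‖(c : ℂ) • S.one‖ ^ 2 = c ^ 2 * S.length := by
    rw [norm_smul, mul_pow, Complex.norm_real, Real.norm_of_nonneg hc, one,
      norm_indicatorConstLp two_ne_zero ENNReal.ofNat_ne_top, norm_one, one_mul,
      measureReal_toSet, ENNReal.toReal_ofNat, ← Real.sqrt_eq_rpow, Real.sq_sqrt S.length_pos.le]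
  rw [← h2]
  exact pow_le_pow_left₀ (norm_nonneg _) h1 2

/-- If `|P.sideSum ± 1| ≥ t`, then `|Ш f| ≥ t |∫ f| / |parent P|` on dyadic `S ⊆ P`, whence a lower
bound for `‖1_K Ш f‖` when `S ⊆ K`. Only `|P.sideSum - 1|` matters if `S` lies in the right half of
`P`. -/
theorem norm_cut_haarShift_sq_ge {I P S K : DyadicInterval} (hSK : S.toSet ⊆ K.toSet)
    (hI : I.toSet ⊆ P.sibling.toSet) (hS : S.toSet ⊆ P.toSet)
    {f : Lp ℂ 2 (volume : Measure ℝ)} (hf : I.Supported f) {t : ℝ} (ht : 0 ≤ t)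
    (hm : S.toSet ⊆ P.childPlus.toSet ∨ t ≤ |P.sideSum + 1|) (hp : t ≤ |P.sideSum - 1|) :
    ‖∫ x in I.toSet, f x‖ ^ 2 * ((t / P.parent.length) ^ 2 * S.length) ≤
      ‖K.cut (haarShift f)‖ ^ 2 := by
  have hL := P.parent.length_pos
  rw [← mul_assoc, ← mul_pow]
  refine sq_mul_length_le_norm_cut_sq hSK (by positivity) ?_
  filter_upwards [haarShift_ae hf hI] with x hx hxS
  rcases mem_children (hS hxS) with h | h
  · rw [hx.1 h, norm_mul, Complex.norm_real, Real.norm_eq_abs, abs_div, abs_of_pos hL]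
    have hm' := hm.resolve_left fun hsub ↦
      Set.disjoint_left.1 P.disjoint_children h (hsub hxS)
    gcongr
  · rw [hx.2 h, norm_mul, Complex.norm_real, Real.norm_eq_abs, abs_div, abs_of_pos hL]
    gcongr

theorem coeFn_extendZero {I : DyadicInterval} {f₀ : ℝ → ℂ} (hf₀ : I.MemL2 f₀) :
    I.extendZero f₀ hf₀ =ᵐ[volume] I.toSet.indicator f₀ :=
  MemLp.coeFn_toLp _

theorem supported_extendZero {I : DyadicInterval} {f₀ : ℝ → ℂ} (hf₀ : I.MemL2 f₀) :
    I.Supported (I.extendZero f₀ hf₀) := by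
  filter_upwards [coeFn_extendZero hf₀] with x hx hI
  rw [hx, indicator_of_notMem hI]

theorem setIntegral_extendZero {I : DyadicInterval} {f₀ : ℝ → ℂ} (hf₀ : I.MemL2 f₀) :
    ∫ x in I.toSet, I.extendZero f₀ hf₀ x = ∫ x in I.toSet, f₀ x := by
  refine setIntegral_congr_ae I.measurableSet_toSet ?_
  filter_upwards [coeFn_extendZero hf₀] with x hx hI
  rw [hx, indicator_of_mem hI]

/-- For functions of small oscillation, the bound of `norm_cut_haarShift_sq_ge` combined with
Wirtinger's inequality bounds `‖1_K Ш f‖` by `‖f‖`. -/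
theorem norm_cut_haarShift_extendZero_sq_ge {I P S K : DyadicInterval} (hSK : S.toSet ⊆ K.toSet)
    (hI : I.toSet ⊆ P.sibling.toSet) (hS : S.toSet ⊆ P.toSet) {t : ℝ} (ht : 0 ≤ t)
    (hm : S.toSet ⊆ P.childPlus.toSet ∨ t ≤ |P.sideSum + 1|) (hp : t ≤ |P.sideSum - 1|)
    {η : ℝ} (hη0 : 0 ≤ η) (hη1 : η ≤ 1) {f₀ g₀ : ℝ → ℂ} (hf₀ : I.MemL2 f₀)
    (h : I.HasFourierDeriv f₀ g₀ ∧ I.length * I.l2norm g₀ ≤ 2 * Real.pi * η * I.l2norm f₀ ∨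
      I.HasWeakDeriv f₀ g₀ ∧ I.length * I.l2norm g₀ ≤ Real.pi * η * I.l2norm f₀)
    {C : ℝ} (hC0 : 0 ≤ C) (hC : C ≤ I.length * ((t / P.parent.length) ^ 2 * S.length)) :
    (1 - η) ^ 2 * C * ‖I.extendZero f₀ hf₀‖ ^ 2 ≤
      ‖K.cut (haarShift (I.extendZero f₀ hf₀))‖ ^ 2 := by
  have h1 := norm_cut_haarShift_sq_ge hSK hI hS (supported_extendZero hf₀) ht hm hp
  have h2 := one_sub_sq_mul_norm_sq_le hf₀ h
  rw [setIntegral_extendZero] at h1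
  refine le_trans ?_ h1
  have hS' := S.length_pos
  have hη : (1 - η) ^ 2 ≤ 1 - η ^ 2 := by nlinarith
  calc (1 - η) ^ 2 * C * ‖I.extendZero f₀ hf₀‖ ^ 2
      ≤ (1 - η ^ 2) * (I.length * ((t / P.parent.length) ^ 2 * S.length)) *
          ‖I.extendZero f₀ hf₀‖ ^ 2 := by
        refine mul_le_mul_of_nonneg_right ?_ (by positivity)
        exact mul_le_mul hη hC hC0 ((sq_nonneg _).trans hη)
    _ = ((1 - η ^ 2) * I.length * ‖I.extendZero f₀ hf₀‖ ^ 2) *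
          ((t / P.parent.length) ^ 2 * S.length) := by ring
    _ ≤ _ := mul_le_mul_of_nonneg_right h2 (by positivity)

/-! ### Dyadic intervals near the origin -/

theorem bounds_of_subset_Icc {J : DyadicInterval} {a b : ℝ} (h : J.toSet ⊆ Icc a b) :
    a ≤ J.left ∧ J.right ≤ b := by
  have h1 := closure_minimal h isClosed_Icc
  rw [toSet, closure_Ico J.left_lt_right.ne] at h1
  exact (Icc_subset_Icc_iff J.left_lt_right.le).1 h1

theorem subset_pos_zero {J : DyadicInterval} {m : ℤ} (h : J.toSet ⊆ Icc 0 ((2 : ℝ) ^ m)) :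
    J.toSet ⊆ toSet ⟨m, 0⟩ := by
  obtain ⟨h1, h2⟩ := bounds_of_subset_Icc h
  exact Ico_subset_Ico (by simpa [left] using h1) (by simpa [right] using h2)

theorem subset_pos_one {J : DyadicInterval} {m : ℤ}
    (h : J.toSet ⊆ Icc ((2 : ℝ) ^ m) ((2 : ℝ) ^ (m + 1))) : J.toSet ⊆ toSet ⟨m, 1⟩ := by
  obtain ⟨h1, h2⟩ := bounds_of_subset_Icc h
  refine Ico_subset_Ico (by simpa [left] using h1) ?_
  rw [zpow_add_one₀ two_ne_zero] at h2
  simpa [right, one_add_one_eq_two] using h2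

theorem sibling_pos_zero (m : ℤ) : sibling ⟨m, 0⟩ = ⟨m, 1⟩ := by simp [sibling]

theorem sibling_pos_one (m : ℤ) : sibling ⟨m, 1⟩ = ⟨m, 0⟩ := by simp [sibling]

theorem pos_nonneg {I : DyadicInterval} (hI : I.toSet ⊆ Ici 0) : 0 ≤ I.pos := by
  have h := hI I.left_mem
  rw [mem_Ici, left] at h
  have h2 := nonneg_of_mul_nonneg_right h (by positivity)
  exact_mod_cast h2

theorem anc_subset_Ici {I : DyadicInterval} (hI : I.toSet ⊆ Ici 0) (n : ℕ) :
    (I.anc n).toSet ⊆ Ici 0 := by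
  have h : 0 ≤ (I.anc n).pos := by
    induction n with
    | zero => exact pos_nonneg hI
    | succ n ih => rw [anc_succ, parent]; dsimp only; omega
  intro x hx
  have h1 : (0 : ℝ) ≤ (I.anc n).pos := by exact_mod_cast h
  have h2 : (0 : ℝ) ≤ (I.anc n).left := by rw [left]; positivity
  exact h2.trans hx.1

theorem disjoint_Iic_Ici {K J : DyadicInterval} (hK : K.toSet ⊆ Iic 0) (hJ : J.toSet ⊆ Ici 0) :
    Disjoint K.toSet J.toSet := by
  have h1 := closure_minimal hK isClosed_Iic
  rw [toSet, closure_Ico K.left_lt_right.ne] at h1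
  have h2 : K.right ≤ 0 := h1 (right_mem_Icc.2 K.left_lt_right.le)
  exact Set.disjoint_left.2 fun x hxK hxJ ↦ absurd (hJ hxJ) (not_le.2 (hxK.2.trans_le h2))

end DyadicInterval

open DyadicInterval in
theorem mainTheorem2 (I K : DyadicInterval) (M₀ : ℤ)
    (hI : I.toSet ⊆ Ici 0)
    (hM₀ : IsLeast {m : ℤ | I.toSet ⊆ Icc 0 ((2 : ℝ) ^ m)} M₀)
    (hKI : Disjoint K.toSet I.toSet) :
    -- on `K`, the Haar shift of `f` depends only on the mean of `f`
    (∀ f : Lp ℂ 2 (volume : Measure ℝ), I.Supported f →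
      K.cut (haarShift f) = (⨍ x in I.toSet, f x) • K.cut (haarShift I.one)) ∧
    -- the positions where it vanishes
    (K.toSet ⊆ Iic 0 →
      ∀ f : Lp ℂ 2 (volume : Measure ℝ), I.Supported f → K.cut (haarShift f) = 0) ∧
    (I.toSet ⊆ Icc ((2 : ℝ) ^ (M₀ - 1)) ((2 : ℝ) ^ M₀) →
      K.toSet ⊆ Icc 0 ((2 : ℝ) ^ (M₀ - 2)) →
      ∀ f : Lp ℂ 2 (volume : Measure ℝ), I.Supported f → K.cut (haarShift f) = 0) ∧
    -- lower bounds for functions with small oscillation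
    (∀ η : ℝ, 0 ≤ η → η ≤ 1 → ∀ (f₀ g₀ : ℝ → ℂ) (hf₀ : I.MemL2 f₀),
      (I.HasFourierDeriv f₀ g₀ ∧
          I.length * I.l2norm g₀ ≤ 2 * Real.pi * η * I.l2norm f₀ ∨
        I.HasWeakDeriv f₀ g₀ ∧
          I.length * I.l2norm g₀ ≤ Real.pi * η * I.l2norm f₀) →
      (∀ k : ℕ, K.toSet ⊆ Icc ((2 : ℝ) ^ (M₀ + k)) ((2 : ℝ) ^ (M₀ + k + 1)) →
        (1 - η) ^ 2 * (I.length * K.length / (2 : ℝ) ^ (2 * (M₀ + k + 1))) *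
            ‖I.extendZero f₀ hf₀‖ ^ 2
          ≤ ‖K.cut (haarShift (I.extendZero f₀ hf₀))‖ ^ 2) ∧
      (I.toSet ⊆ Icc ((2 : ℝ) ^ (M₀ - 1)) ((2 : ℝ) ^ M₀) →
        (K.toSet ⊆ Icc ((2 : ℝ) ^ (M₀ - 2)) ((2 : ℝ) ^ (M₀ - 1)) →
          (1 - η) ^ 2 * (I.length * K.length / (2 : ℝ) ^ (2 * (M₀ - 1))) *
              ‖I.extendZero f₀ hf₀‖ ^ 2
            ≤ ‖K.cut (haarShift (I.extendZero f₀ hf₀))‖ ^ 2) ∧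
        (K.toSet = Ico 0 ((2 : ℝ) ^ (M₀ - 1)) →
          (1 - η) ^ 2 * (I.length / (2 : ℝ) ^ M₀) * ‖I.extendZero f₀ hf₀‖ ^ 2
            ≤ ‖K.cut (haarShift (I.extendZero f₀ hf₀))‖ ^ 2) ∧
        (K.toSet ⊆ Icc ((2 : ℝ) ^ (M₀ - 1)) ((2 : ℝ) ^ M₀) →
          ∃ L : DyadicInterval, DyadicInterval.IsMeet K I L ∧
            (1 - η) ^ 2 * (I.length * K.length * L.length ^ 2 / (2 : ℝ) ^ (4 * M₀)) *
                ‖I.extendZero f₀ hf₀‖ ^ 2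
              ≤ ‖K.cut (haarShift (I.extendZero f₀ hf₀))‖ ^ 2))) ∧
    -- no lower bound holds for all functions supported in `I`
    ¬ ∃ C : ℝ, 0 < C ∧ ∀ f : Lp ℂ 2 (volume : Measure ℝ), I.Supported f →
        C * ‖f‖ ^ 2 ≤ ‖K.cut (haarShift f)‖ ^ 2 := by
  have hlI := I.length_pos
  have hlK := K.length_pos
  have hI0 : I.toSet ⊆ Icc 0 ((2 : ℝ) ^ M₀) := hM₀.1
  have hIr (h : I.toSet ⊆ Icc ((2 : ℝ) ^ (M₀ - 1)) ((2 : ℝ) ^ M₀)) :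
      I.toSet ⊆ (sibling ⟨M₀ - 1, 0⟩).toSet := by
    rw [sibling_pos_zero]
    exact subset_pos_one (by rwa [sub_add_cancel])
  have hpar : (parent ⟨M₀ - 1, 0⟩).length = (2 : ℝ) ^ M₀ := by simp [parent, length]
  have hsum := sideSum_pos_zero (M₀ - 1)
  have hz : (2 : ℝ) ^ (M₀ - 1) = 2 ^ M₀ / 2 := by rw [zpow_sub_one₀ two_ne_zero]; ring
  have hz2 : (2 : ℝ) ^ (M₀ - 2) = 2 ^ M₀ / 4 := by
    rw [show M₀ - 2 = M₀ - 1 - 1 by ring, zpow_sub_one₀ two_ne_zero, hz]; ring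
  refine ⟨fun f hf ↦ cut_haarShift_eq_average_smul hKI hf,
    fun hK f hf ↦ cut_haarShift_eq_zero hKI (fun n ↦ disjoint_Iic_Ici hK (anc_subset_Ici hI n)) hf,
    fun hI1 hK f hf ↦ ?_, fun η hη0 hη1 f₀ g₀ hf₀ h ↦ ⟨fun k hK ↦ ?_, fun hI1 ↦
      ⟨fun hK ↦ ?_, fun hK ↦ ?_, fun hK ↦ ?_⟩⟩, ?_⟩
  · have hK' : K.toSet ⊆ (childMinus ⟨M₀ - 1, 0⟩).toSet := by
      have := subset_pos_zero hK
      simpa [childMinus, sub_sub] using this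
    rw [← K.cut_zero]
    refine cut_congr ?_
    filter_upwards [haarShift_ae hf (hIr hI1), Lp.coeFn_zero ℂ 2 (volume : Measure ℝ)]
      with x h1 h2 hx
    rw [h1.1 (hK' hx), h2, hsum]
    simp
  · have hKP : K.toSet ⊆ toSet ⟨M₀ + k, 1⟩ := subset_pos_one hK
    have hIP : I.toSet ⊆ (sibling ⟨M₀ + k, 1⟩).toSet := by
      rw [sibling_pos_one]
      refine subset_pos_zero (hI0.trans (Icc_subset_Icc_right ?_))
      exact zpow_le_zpow_right₀ one_le_two (by omega)
    refine norm_cut_haarShift_extendZero_sq_ge (t := 1) subset_rfl hIP hKP zero_le_one (.inr ?_) ?_ hη0 hη1 hf₀ h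
      (by positivity) (le_of_eq ?_)
    · rw [sideSum_pos_one]; norm_num
    · rw [sideSum_pos_one]; norm_num
    · have : (parent ⟨M₀ + k, 1⟩).length = (2 : ℝ) ^ (M₀ + k + 1) := rfl
      rw [this, mul_comm 2, zpow_mul, zpow_ofNat]
      ring
  · have hK' : K.toSet ⊆ (childPlus ⟨M₀ - 1, 0⟩).toSet := by
      have := subset_pos_one (m := M₀ - 2) (by rwa [show M₀ - 2 + 1 = M₀ - 1 by ring])
      simpa [childPlus, sub_sub] using this
    refine norm_cut_haarShift_extendZero_sq_ge (t := 2) subset_rfl (hIr hI1) (hK'.trans (childPlus_subset _)) zero_le_two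
      (.inl hK') ?_ hη0 hη1 hf₀ h (by positivity) (le_of_eq ?_)
    · rw [hsum]; norm_num
    · rw [hpar, mul_comm 2 (M₀ - 1), zpow_mul, zpow_ofNat, hz]
      field_simp
  · have hKe : K.toSet = toSet ⟨M₀ - 1, 0⟩ := by rw [hK]; simp [toSet, left, right]
    -- on the left half of `K` the image vanishes, so only the right half contributes
    refine norm_cut_haarShift_extendZero_sq_ge (t := 2) (hKe ▸ childPlus_subset _) (hIr hI1) (childPlus_subset _)
      zero_le_two (.inl subset_rfl) ?_ hη0 hη1 hf₀ h (by positivity) (le_of_eq ?_)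
    · rw [hsum]; norm_num
    · have : (DyadicInterval.length ⟨M₀ - 1, 0⟩) = (2 : ℝ) ^ M₀ / 2 := hz
      rw [hpar, childPlus_length, this]
      field_simp
  · have hKR : K.toSet ⊆ toSet ⟨M₀ - 1, 1⟩ := subset_pos_one (by rwa [sub_add_cancel])
    have hIR : I.toSet ⊆ toSet ⟨M₀ - 1, 1⟩ := subset_pos_one (by rwa [sub_add_cancel])
    obtain ⟨P, hKP, hIP, hPR⟩ := exists_sibling_of_disjoint hKI hKR hIR
    refine ⟨P.parent, isMeet_parent hKP hIP, ?_⟩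
    obtain ⟨n, hn⟩ := exists_anc_eq_of_subset hPR
    have hlen := P.parent.anc_length n
    have hge := P.one_sub_abs_sideSum_ge (n + 1)
    rw [← anc_succ'] at hn hlen
    have hlR : DyadicInterval.length ⟨M₀ - 1, 1⟩ = (2 : ℝ) ^ M₀ / 2 := hz
    rw [hn, sideSum_pos_one, abs_zero, sub_zero] at hge
    rw [hn, hlR] at hlen
    have hl := P.parent.length_pos
    -- the distance of `P.sideSum` from `±1` is at least `|L| / 2 ^ M₀`
    have ht : P.parent.length / 2 ^ M₀ = 1 / 2 ^ (n + 1) := by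
      rw [pow_succ, eq_div_iff (by positivity)]
      field_simp
      linarith
    have hle : P.parent.length / 2 ^ M₀ ≤ 1 := by
      rw [ht]
      exact div_le_one_of_le₀ (one_le_pow₀ one_le_two) (by positivity)
    rw [← ht] at hge
    have habs := abs_le.1 (show |P.sideSum| ≤ 1 - P.parent.length / 2 ^ M₀ by linarith)
    refine norm_cut_haarShift_extendZero_sq_ge (t := P.parent.length / 2 ^ M₀) subset_rfl hIP hKP (by positivity)
      (.inr (le_abs.2 (.inl (by linarith)))) (le_abs.2 (.inr (by linarith))) hη0 hη1 hf₀ h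
      (by positivity) ?_
    have h4 : (2 : ℝ) ^ (4 * M₀) = (2 ^ M₀) ^ 4 := by
      rw [mul_comm, zpow_mul]; norm_cast
    calc I.length * K.length * P.parent.length ^ 2 / (2 : ℝ) ^ (4 * M₀)
        = I.length * K.length / (2 ^ M₀) ^ 2 * (P.parent.length / 2 ^ M₀) ^ 2 := by
          rw [h4]; field_simp
      _ ≤ I.length * K.length / (2 ^ M₀) ^ 2 * 1 := by
          refine mul_le_mul_of_nonneg_left (pow_le_one₀ (by positivity) hle) (by positivity)
      _ = _ := by field_simp
  · -- the Haar function of `I` has mean zero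
    rintro ⟨C, hC, h⟩
    have h1 := h I.haar I.supported_haar
    rw [cut_haarShift_eq_average_smul hKI I.supported_haar, setAverage_eq, setIntegral_haar,
      smul_zero, zero_smul, norm_zero, orthonormal_haar.1 I] at h1
    norm_num at h1
    linarith

end
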